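/- Let $(X_n)_{n\in\mathbb Z}$ be a strictly stationary sequence of real random variables on a probability space $(\Omega,\mathcal F,\mathrm P)$ that is regularly varying with index $\alpha\in(1,2)$: $\mathrm P(|X_1|>x)=x^{-\alpha}L(x)$ for $x>0$, where $L$ is slowly varying at $\infty$, and, for some $p\in[0,1]$, $\mathrm P(X_1>x)/\mathrm P(|X_1|>x)\to p$ and $\mathrm P(X_1<-x)/\mathrm P(|X_1|>x)\to 1-p$ as $x\to\infty$. Let $(a_n)$ be a sequence of positive real numbers with $n\,\mathrm P(|X_1|>a_n)\to 1$ as $n\to\infty$, and let $(r_n)$ be a sequence of positive integers with $r_n\to\infty$ and $r_n=o(n^s)$ for some $0<s<2/\alpha-1$. For $\sigma$-fields $\mathcal A,\mathcal B\subseteq\mathcal F$ put $$\rho(\mathcal A,\mathcal B)=\sup\Big\{\frac{|\mathrm E(UV)-\mathrm EU\,\mathrm EV|}{\sqrt{\mathrm EU^2\,\mathrm EV^2}}: U\in L_2(\mathcal A),\ V\in L_2(\mathcal B)\Big\}\qquad (0/0:=0),$$ where $L_2(\mathcal A)$ is the space of square-integrable $\mathcal A$-measurable real random variables, and let $\rho_n=\sup_{j\in\mathbb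 Z}\rho\big(\sigma(X_i:i\le j),\sigma(X_i:i\ge j+n)\big)$ be the $\rho$-mixing coefficients of $(X_n)$. Suppose that $(\rho_n)$ decreases (in the weak sense) to zero as $n\to\infty$ and that $\sum_{j\ge 0}\rho_{\lfloor 2^{j/3}\rfloor}<\infty$. Write $k_n=\lfloor n/r_n\rfloor$ and $S_{r_n}^k=X_{(k-1)r_n+1}+\dots+X_{kr_n}$ for $k\ge 1$. Then $k_n\to\infty$ as $n\to\infty$, and for every $\delta>0$ $$\lim_{u\downarrow 0}\limsup_{n\to\infty}\mathrm P\bigg[\max_{1\le j\le k_n}\bigg|\sum_{k=1}^{j}\bigg(\frac{S_{r_n}^k}{a_n}1_{\{|S_{r_n}^k|/a_n\le u\}}-\mathrm E\Big(\frac{S_{r_n}^k}{a_n}1_{\{|S_{r_n}^k|/a_n\le u\}}\Big)\bigg)\bigg|>\delta\bigg]=0.$$ -/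

import Mathlib

open MeasureTheory ProbabilityTheory Filter Topology Asymptotics

noncomputable section

/-- Strict stationarity of a two-sided real sequence: the law of the whole sequence is invariant
under every shift of the time index. -/
def StrictlyStationary {Ω : Type*} [MeasurableSpace Ω] (P : Measure Ω) (X : ℤ → Ω → ℝ) : Prop :=
  ∀ h : ℤ, IdentDistrib (fun ω (n : ℤ) => X (n + h) ω) (fun ω (n : ℤ) => X n ω) P P

/-- `L` is slowly varying at infinity: measurable, eventually positive, and
`L (c x) / L x → 1` as `x → ∞` for every `c > 0`. -/
structure SlowlyVarying (L : ℝ → ℝ) : Prop where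
  measurable : Measurable L
  eventually_pos : ∀ᶠ x in atTop, 0 < L x
  tendsto_ratio : ∀ c : ℝ, 0 < c → Tendsto (fun x => L (c * x) / L x) atTop (𝓝 1)

/-- The real random variable `Y` is regularly varying with index `α`:
`P(|Y| > x) = x^(-α) L(x)` with `L` slowly varying, and the tails are balanced, i.e.
`P(Y > x) / P(|Y| > x) → p` and `P(Y < -x) / P(|Y| > x) → 1 - p` for some `p ∈ [0, 1]`. -/
structure RegularlyVarying {Ω : Type*} [MeasurableSpace Ω] (P : Measure Ω) (Y : Ω → ℝ) (α : ℝ) :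
    Prop where
  tail : ∃ L : ℝ → ℝ, SlowlyVarying L ∧
    ∀ x : ℝ, 0 < x → P.real {ω | x < |Y ω|} = x ^ (-α) * L x
  balance : ∃ p ∈ Set.Icc (0 : ℝ) 1,
    Tendsto (fun x : ℝ => P.real {ω | x < Y ω} / P.real {ω | x < |Y ω|}) atTop (𝓝 p) ∧
    Tendsto (fun x : ℝ => P.real {ω | Y ω < -x} / P.real {ω | x < |Y ω|}) atTop (𝓝 (1 - p))

/-- The coefficient `ρ(𝒜, ℬ)`: the supremum of `|E(UV) - E U E V| / √(E U² E V²)` over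
square-integrable `U`, `V` measurable with respect to `𝒜` and `ℬ` (with `0 / 0 = 0`).
For `𝒜, ℬ` contained in the ambient σ-field and a probability measure, all the ratios
are at most `1`. -/
def rhoCoeff {Ω : Type*} [MeasurableSpace Ω] (P : Measure Ω) (𝒜 ℬ : MeasurableSpace Ω) : ℝ :=
  sSup {c : ℝ | ∃ U V : Ω → ℝ,
    Measurable[𝒜] U ∧ MemLp U 2 P ∧ Measurable[ℬ] V ∧ MemLp V 2 P ∧
    c = |(∫ ω, U ω * V ω ∂P) - (∫ ω, U ω ∂P) * (∫ ω, V ω ∂P)| /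
      √((∫ ω, U ω ^ 2 ∂P) * (∫ ω, V ω ^ 2 ∂P))}

/-- The σ-field generated by the variables `X i`, `i ∈ I`. -/
abbrev sigmaField {Ω : Type*} (X : ℤ → Ω → ℝ) (I : Set ℤ) : MeasurableSpace Ω :=
  ⨆ i ∈ I, MeasurableSpace.comap (X i) inferInstance

/-- The `ρ`-mixing coefficients `ρ(n) = sup_j ρ(σ(X i, i ≤ j), σ(X i, i ≥ j + n))`. -/
def rhoMixing {Ω : Type*} [MeasurableSpace Ω] (P : Measure Ω) (X : ℤ → Ω → ℝ) (n : ℕ) : ℝ :=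
  ⨆ j : ℤ, rhoCoeff P (sigmaField X (Set.Iic j)) (sigmaField X (Set.Ici (j + n)))

/-- The `k`-th block sum `X_{(k-1)r+1} + ⋯ + X_{kr}` of block length `r` (for `k ≥ 1`). -/
def blockSum {Ω : Type*} (X : ℤ → Ω → ℝ) (r k : ℕ) (ω : Ω) : ℝ :=
  ∑ i ∈ Finset.Icc (((k : ℤ) - 1) * r + 1) ((k : ℤ) * r), X i ω

/-- The truncation `x · 1{|x| ≤ u}`. -/
def truncAt (u x : ℝ) : ℝ := Set.indicator {y : ℝ | |y| ≤ u} id x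

/-- The truncated and centred normalised block sum
`(S / a) 1{|S| / a ≤ u} - E((S / a) 1{|S| / a ≤ u})`, where `S` is the `k`-th block sum of block
length `r` and `a` is the normalisation. -/
def centredBlock {Ω : Type*} [MeasurableSpace Ω] (P : Measure Ω) (X : ℤ → Ω → ℝ)
    (a : ℝ) (r : ℕ) (u : ℝ) (k : ℕ) (ω : Ω) : ℝ :=
  truncAt u (blockSum X r k ω / a) - ∫ ω', truncAt u (blockSum X r k ω' / a) ∂P

/-- Asymptotic negligibility of the small block sums, for the block lengths `r n` and
`k n = ⌊n / r n⌋`: the `r n` are positive integers, `r n → ∞`, `k n → ∞`, and for all `δ > 0`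
`lim_{u ↓ 0} limsup_n P(max_{1 ≤ j ≤ k n} |∑_{k = 1}^j Z_k(u, n)| > δ) = 0`,
where `Z_k(u, n)` is the truncated and centred normalised `k`-th block sum. -/
structure SmallBlocksNegligible {Ω : Type*} [MeasurableSpace Ω] (P : Measure Ω) (X : ℤ → Ω → ℝ)
    (a : ℕ → ℝ) (r : ℕ → ℕ) : Prop where
  pos : ∀ n, 0 < r n
  tendsto_length : Tendsto r atTop atTop
  tendsto_number : Tendsto (fun n => n / r n) atTop atTop
  negligible : ∀ δ : ℝ, 0 < δ →
    Tendsto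
      (fun u : ℝ => limsup
        (fun n : ℕ => P {ω | ∃ j ∈ Finset.Icc 1 (n / r n),
          δ < |∑ k ∈ Finset.Icc 1 j, centredBlock P X (a n) (r n) u k ω|}) atTop)
      (𝓝[>] 0) (𝓝 0)

end

/-!
Chebyshev's inequality reduces the claim to a maximal inequality in `L²` and a bound on the second
moment of one truncated block.

*Maximal inequality* (`exists_isMaximalConstant`). For centred variables with `‖Y i‖₂ ≤ σ`,
adapted to a filtration and `ρ`-mixing with respect to it,
`E max_{j ≤ N} |Y 0 + ⋯ + Y (j - 1)|² ≤ C N σ²`, where `C` depends only on the mixing rate. Two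
ingredients enter.
The first, `dyadic_maximal`, holds for every adapted sequence (the method of Peligrad and Utev):
subtract the martingale of the increments `Y i - E(Y i | F i)`, whose maximum Doob's inequality
controls, and add up the compensators `E(Y i | F i)` in pairs. The pairs form an adapted sequence
along the even times, of half the length, so the step can be repeated; the norms of
the conditional expectations of the sums over dyadic blocks given the past of the block, divided by
`√2 ^ l`, are summed over the scales `l`.
The second ingredient bounds these conditional expectations. Discard the first
`gapLength l = ⌊2 ^ (l / 3)⌋` terms of a block of length `2 ^ l`: they have norm at most
`2 ^ (l / 3) σ`, which is summable against `2 ^ (-l / 2)`, and the rest is separated from the past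
by a gap, so that it contributes at most `ρ (gapLength l)` times the norm of the block
(`MixingBound.abs_integral_mul_sum_le`). The same covariance estimate, applied to two neighbouring
blocks, shows that the variance of a block of length `2 ^ l` is at most a constant times `2 ^ l σ²`
(`MixingBound.lpNorm_dyadic_sum_le`).

*Second moment of a block* (`integral_truncAt_blockSum_sq_le`). Write `t = u a n`, and `G` for the
tail of `|X 1|`. Either all terms of the block are at most `t` in modulus, and the block sum is the
sum of the truncated terms, or one of them exceeds `t`, which has probability at most `r G(t)`. The
maximal inequality applied to the truncated, centred `X i` bounds the variance in the first
case by `C r E(X² 1{|X| ≤ t})`, and the truncated means are bounded because `α > 1`. Since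
`E(X² 1{|X| ≤ t}) ≤ K t² G(t)` and `n G(u a n) → u ^ (-α)`, all but the contribution of the
means tends to a multiple of `u ^ (2 - α)`, which vanishes as `u → 0`. The means
contribute a multiple of `n r n / (a n)²`, which tends to `0` as `r n = o(n ^ s)` and
`s < 2 / α - 1` (`RegularlyVarying.tendsto_mul_div_sq`). The estimates on the tail all
come from comparing `G (2 y)` with `G y` and iterating (`doubling_induction`).
-/

/-! ### `L²` norms and Doob's maximal inequality -/

theorem lpNorm_two_sq {Ω : Type*} {m0 : MeasurableSpace Ω} {P : Measure Ω} {f : Ω → ℝ}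
    (hf : AEStronglyMeasurable f P) : lpNorm f 2 P ^ 2 = ∫ ω, f ω ^ 2 ∂P := by
  rw [lpNorm_eq_integral_norm_rpow_toReal (by norm_num) (by norm_num) hf]
  have h0 : 0 ≤ ∫ x, ‖f x‖ ^ (2 : ENNReal).toReal ∂P := integral_nonneg fun _ => by positivity
  rw [← Real.rpow_natCast, ← Real.rpow_mul h0]
  simp

theorem lpNorm_two_eq_sqrt {Ω : Type*} {m0 : MeasurableSpace Ω} {P : Measure Ω} {f : Ω → ℝ}
    (hf : AEStronglyMeasurable f P) : lpNorm f 2 P = √(∫ ω, f ω ^ 2 ∂P) := by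
  rw [← lpNorm_two_sq hf, Real.sqrt_sq lpNorm_nonneg]

theorem abs_integral_mul_le_lpNorm {Ω : Type*} {m0 : MeasurableSpace Ω} {P : Measure Ω}
    {f g : Ω → ℝ} (hf : MemLp f 2 P) (hg : MemLp g 2 P) :
    |∫ ω, f ω * g ω ∂P| ≤ lpNorm f 2 P * lpNorm g 2 P := by
  have h := abs_real_inner_le_norm (hg.toLp g) (hf.toLp f)
  rw [L2.inner_def, Lp.norm_toLp, Lp.norm_toLp, toReal_eLpNorm hf.1, toReal_eLpNorm hg.1,
    mul_comm] at h
  refine le_of_eq_of_le ?_ h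
  congr 1
  refine integral_congr_ae ?_
  filter_upwards [hf.coeFn_toLp, hg.coeFn_toLp] with ω h1 h2
  simp [h1, h2]

theorem integral_mul_condExp_eq {Ω : Type*} {m m0 : MeasurableSpace Ω} (hm : m ≤ m0)
    {P : Measure[m0] Ω} [IsProbabilityMeasure P] {U V : Ω → ℝ} (hU : Measurable[m] U)
    (hU2 : MemLp U 2 P) (hV : MemLp V 2 P) :
    ∫ ω, U ω * (P[V | m]) ω ∂P = ∫ ω, U ω * V ω ∂P := by
  have h := condExp_mul_of_stronglyMeasurable_left (μ := P) hU.stronglyMeasurable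
    (hU2.integrable_mul hV) (hV.integrable (by norm_num))
  rw [← integral_condExp hm (f := fun ω => U ω * V ω)]
  exact integral_congr_ae (h.symm)

theorem lpNorm_congr_ae {Ω : Type*} {m0 : MeasurableSpace Ω} {P : Measure Ω} {f g : Ω → ℝ}
    (h : f =ᵐ[P] g) : lpNorm f 2 P = lpNorm g 2 P := by
  by_cases hf : AEStronglyMeasurable f P
  · rw [← toReal_eLpNorm hf, ← toReal_eLpNorm (hf.congr h), eLpNorm_congr_ae h]
  · rw [lpNorm_of_not_aestronglyMeasurable hf,
      lpNorm_of_not_aestronglyMeasurable (fun hg => hf (hg.congr h.symm))]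

/-- The `L²` substitute for a maximum: `√(∑ R i ²)` dominates every `|R i|`, and its squared norm
is the sum of the squared norms. -/
theorem sum_sq_memLp {Ω ι : Type*} {m0 : MeasurableSpace Ω} {P : Measure Ω}
    (s : Finset ι) {R : ι → Ω → ℝ} (hR : ∀ i ∈ s, MemLp (R i) 2 P) :
    MemLp (fun ω => √(∑ i ∈ s, R i ω ^ 2)) 2 P ∧
    lpNorm (fun ω => √(∑ i ∈ s, R i ω ^ 2)) 2 P ^ 2 = ∑ i ∈ s, lpNorm (R i) 2 P ^ 2 := by
  have hmeas : AEStronglyMeasurable (fun ω => √(∑ i ∈ s, R i ω ^ 2)) P :=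
    Real.continuous_sqrt.comp_aestronglyMeasurable
      (Finset.aestronglyMeasurable_fun_sum s fun i hi => (hR i hi).1.pow 2)
  have hsq : (fun ω => √(∑ i ∈ s, R i ω ^ 2) ^ 2) = fun ω => ∑ i ∈ s, R i ω ^ 2 := by
    ext ω
    exact Real.sq_sqrt (Finset.sum_nonneg fun i _ => sq_nonneg _)
  constructor
  · rw [memLp_two_iff_integrable_sq hmeas, hsq]
    exact integrable_finsetSum _ fun i hi => (hR i hi).integrable_sq
  · rw [lpNorm_two_sq hmeas, hsq, integral_finsetSum _ fun i hi => (hR i hi).integrable_sq]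
    exact Finset.sum_congr rfl fun i hi => (lpNorm_two_sq (hR i hi).1).symm

/-- Pathwise form of Doob's `L²` maximal inequality. In expectation the sum on the left vanishes
when `s` is a martingale, since the factor in front of each increment depends on the past only. -/
theorem pathwise_doob (s : ℕ → ℝ) (n : ℕ) :
    (partialSups (fun i => |s i|) n) ^ 2 + 4 * ∑ i ∈ Finset.range n,
      partialSups (fun i => |s i|) i * SignType.sign (s i) * (s (i + 1) - s i) ≤ 4 * s n ^ 2 := by
  -- summation by parts: where the running maximum grows, its new value is `|s|`
  have key : ∀ n, (partialSups (fun i => |s i|) n) ^ 2 / 2 + ∑ i ∈ Finset.range n,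
      partialSups (fun i => |s i|) i * SignType.sign (s i) * (s (i + 1) - s i)
      ≤ partialSups (fun i => |s i|) n * |s n| := by
    intro n
    induction n with
    | zero => simp; nlinarith [sq_abs (s 0), sq_nonneg (s 0)]
    | succ n ih =>
      rw [Finset.sum_range_succ]
      set A := partialSups (fun i => |s i|) n with hA
      have hAn : |s n| ≤ A := le_partialSups (fun i => |s i|) n
      have hA0 : 0 ≤ A := (abs_nonneg _).trans hAn
      have hs : A * SignType.sign (s n) * (s (n + 1) - s n) ≤ A * |s (n + 1)| - A * |s n| := by
        have h1 : (SignType.sign (s n) : ℝ) * s n = |s n| := sign_mul_self _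
        have h2 : (SignType.sign (s n) : ℝ) * s (n + 1) ≤ |s (n + 1)| := by
          rcases lt_trichotomy (s n) 0 with h | h | h
          · simp [sign_neg h, neg_le_abs]
          · simp [h]
          · simp [sign_pos h, le_abs_self]
        nlinarith [mul_le_mul_of_nonneg_left h2 hA0]
      rw [partialSups_add_one]
      rcases le_total |s (n + 1)| A with h | h
      · rw [sup_eq_left.2 h]; linarith
      · rw [sup_eq_right.2 h]; nlinarith [sq_nonneg (|s (n + 1)| - A)]
  have := key n
  have h2 : s n ^ 2 = |s n| ^ 2 := (sq_abs _).symm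
  nlinarith [sq_nonneg (partialSups (fun i => |s i|) n - 2 * |s n|)]

theorem measurable_sign_real : Measurable fun x : ℝ => ((SignType.sign x : SignType) : ℝ) := by
  have : (fun x : ℝ => ((SignType.sign x : SignType) : ℝ)) =
      fun x => if 0 < x then 1 else if x < 0 then -1 else 0 := by
    ext x
    rw [sign_apply]
    split_ifs <;> simp
  rw [this]
  exact Measurable.ite measurableSet_Ioi measurable_const
    (Measurable.ite measurableSet_Iio measurable_const measurable_const)

/-- Doob's `L²` maximal inequality. The `D i` are martingale differences, expressed as
orthogonality to `L²(F i)`; the maximum is represented by a dominating function `g`. -/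
theorem doob_maximal {Ω : Type*} {m0 : MeasurableSpace Ω} {P : Measure Ω} [IsProbabilityMeasure P]
    (F : Filtration ℕ m0) {D : ℕ → Ω → ℝ} (hD : ∀ i, MemLp (D i) 2 P)
    (hDF : ∀ i, Measurable[F (i + 1)] (D i))
    (horth : ∀ i (U : Ω → ℝ), Measurable[F i] U → MemLp U 2 P → ∫ ω, U ω * D i ω ∂P = 0) (n : ℕ) :
    ∃ g : Ω → ℝ, MemLp g 2 P ∧ lpNorm g 2 P ^ 2 ≤ 4 * ∑ i ∈ Finset.range n, lpNorm (D i) 2 P ^ 2 ∧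
      ∀ ω, ∀ j ≤ n, |∑ i ∈ Finset.range j, D i ω| ≤ g ω := by
  set M : ℕ → Ω → ℝ := fun j ω => ∑ i ∈ Finset.range j, D i ω with hM
  have hM2 : ∀ j, MemLp (M j) 2 P := fun j => memLp_finsetSum _ fun i _ => hD i
  have hMF : ∀ j, Measurable[F j] (M j) := fun j =>
    Finset.measurable_fun_sum _ fun i hi =>
      (hDF i).mono (F.mono (Finset.mem_range.1 hi)) le_rfl
  set A : ℕ → Ω → ℝ := fun j ω => partialSups (fun i => |M i ω|) j with hA
  have hA0 : A 0 = fun ω => |M 0 ω| := by ext ω; simp [hA]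
  have hAs : ∀ j, A (j + 1) = fun ω => max (A j ω) |M (j + 1) ω| := fun j => by
    ext ω
    exact partialSups_add_one _ _
  have hA2 : ∀ j, MemLp (A j) 2 P := by
    intro j
    induction j with
    | zero => rw [hA0]; exact (hM2 0).abs
    | succ j ih => rw [hAs]; exact ih.sup (hM2 (j + 1)).abs
  have hAF : ∀ j, Measurable[F j] (A j) := by
    intro j
    induction j with
    | zero => rw [hA0]; exact continuous_abs.measurable.comp (hMF 0)
    | succ j ih =>
      rw [hAs]
      exact Measurable.max (ih.mono (F.mono (Nat.le_succ j)) le_rfl)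
        (continuous_abs.measurable.comp (hMF (j + 1)))
  have hUm : ∀ i, Measurable[F i] fun ω => A i ω * SignType.sign (M i ω) := fun i =>
    (hAF i).mul (measurable_sign_real.comp (hMF i))
  have hU2 : ∀ i, MemLp (fun ω => A i ω * SignType.sign (M i ω)) 2 P := by
    intro i
    refine (hA2 i).mono ((hUm i).mono (F.le i) le_rfl).aestronglyMeasurable
      (Eventually.of_forall fun ω => ?_)
    rw [norm_mul]
    refine mul_le_of_le_one_right (norm_nonneg _) ?_
    cases SignType.sign (M i ω) <;> simp
  have hpast : ∀ i, ∫ ω, (A i ω * SignType.sign (M i ω)) * D i ω ∂P = 0 := fun i =>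
    horth i _ (hUm i) (hU2 i)
  have hUD : ∀ i, Integrable (fun ω => A i ω * SignType.sign (M i ω) * D i ω) P := fun i =>
    (hU2 i).integrable_mul (hD i)
  have hMsq : ∀ j, ∫ ω, M j ω ^ 2 ∂P = ∑ i ∈ Finset.range j, lpNorm (D i) 2 P ^ 2 := by
    intro j
    induction j with
    | zero => simp [hM]
    | succ j ih =>
      have h1 : ∀ ω, M (j + 1) ω ^ 2 = M j ω ^ 2 + 2 * (M j ω * D j ω) + D j ω ^ 2 := by
        intro ω
        simp only [hM, Finset.sum_range_succ]
        ring
      have hi : Integrable (fun ω => M j ω * D j ω) P := (hM2 j).integrable_mul (hD j)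
      simp_rw [h1]
      have hi2 : Integrable (fun ω => M j ω ^ 2 + 2 * (M j ω * D j ω)) P :=
        (hM2 j).integrable_sq.add (hi.const_mul 2)
      rw [integral_add hi2 (hD j).integrable_sq,
        integral_add (hM2 j).integrable_sq (hi.const_mul 2), integral_const_mul,
        horth j _ (hMF j) (hM2 j), ih, Finset.sum_range_succ, lpNorm_two_sq (hD j).1]
      ring
  refine ⟨A n, hA2 n, ?_, fun ω j hj => ?_⟩
  · rw [lpNorm_two_sq (hA2 n).1, ← hMsq n, ← integral_const_mul]
    have h0 : ∫ ω, 4 * ∑ i ∈ Finset.range n, A i ω * SignType.sign (M i ω) * D i ω ∂P = 0 := by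
      rw [integral_const_mul, integral_finsetSum _ fun i _ => hUD i]
      simp [hpast]
    have hint : Integrable (fun ω => 4 * ∑ i ∈ Finset.range n,
        A i ω * SignType.sign (M i ω) * D i ω) P :=
      (integrable_finsetSum _ fun i _ => hUD i).const_mul 4
    calc ∫ ω, A n ω ^ 2 ∂P = ∫ ω, (A n ω ^ 2 + 4 * ∑ i ∈ Finset.range n,
          A i ω * SignType.sign (M i ω) * D i ω) ∂P := by
            rw [integral_add (hA2 n).integrable_sq hint, h0, add_zero]
      _ ≤ ∫ ω, 4 * M n ω ^ 2 ∂P := by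
        refine integral_mono ((hA2 n).integrable_sq.add hint)
          ((hM2 n).integrable_sq.const_mul 4) fun ω => ?_
        have h := pathwise_doob (fun i => M i ω) n
        have h2 : ∀ i, M (i + 1) ω - M i ω = D i ω := fun i => by
          simp [hM, Finset.sum_range_succ]
        simpa only [h2] using h
  · exact (le_partialSups (fun i => |M i ω|) j).trans
      ((partialSups (fun i => |M i ω|)).mono hj)

/-! ### The dyadic maximal inequality for adapted sequences -/

theorem sum_range_two_mul_pair (f : ℕ → ℝ) (q : ℕ) :
    ∑ k ∈ Finset.range q, (f (2 * k) + f (2 * k + 1)) = ∑ i ∈ Finset.range (2 * q), f i := by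
  induction q with
  | zero => simp
  | succ q ih =>
    rw [Finset.sum_range_succ, ih, mul_add, mul_one, Finset.sum_range_succ, Finset.sum_range_succ]
    ring

theorem sum_Ico_two_mul_pair {M : Type*} [AddCommGroup M] (f : ℕ → M) {a b : ℕ} (hab : a ≤ b) :
    ∑ k ∈ Finset.Ico a b, (f (2 * k) + f (2 * k + 1)) =
      ∑ i ∈ Finset.Ico (2 * a) (2 * b), f i := by
  induction b, hab using Nat.le_induction with
  | base => simp
  | succ b hab ih =>
    rw [Finset.sum_Ico_succ_top hab, ih, mul_add, mul_one, Finset.sum_Ico_succ_top (by omega),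
      Finset.sum_Ico_succ_top (by omega)]
    abel

/-- Tower property: replacing the variables by their compensators does not change the conditional
expectation of a sum given the past of its first index. -/
theorem condExp_sum_condExp_eq {Ω : Type*} {m0 : MeasurableSpace Ω} {P : Measure Ω}
    [IsProbabilityMeasure P] (F : Filtration ℕ m0) {Z : ℕ → Ω → ℝ} (hZ : ∀ i, MemLp (Z i) 2 P)
    (a b : ℕ) :
    P[∑ t ∈ Finset.Ico a b, P[Z t | F t] | F a] =ᵐ[P] P[∑ t ∈ Finset.Ico a b, Z t | F a] := by
  refine (condExp_finsetSum (fun i _ => integrable_condExp) _).trans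
    (EventuallyEq.trans ?_
      (condExp_finsetSum (fun i _ => (hZ i).integrable (by norm_num)) _).symm)
  have h : ∀ᵐ ω ∂P, ∀ t ∈ Finset.Ico a b, (P[P[Z t | F t] | F a]) ω = (P[Z t | F a]) ω := by
    rw [eventually_all_finset]
    intro t ht
    exact condExp_condExp_of_le (F.mono (Finset.mem_Ico.1 ht).1) (F.le t)
  filter_upwards [h] with ω hω
  simp only [Finset.sum_apply]
  exact Finset.sum_congr rfl hω

/-- Maximal inequality for an adapted sequence in terms of the conditional expectations of its
sums over dyadic blocks. The constant `6` is what the induction needs: each step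
costs `2 (c + d 0)` for the martingale, `d 0` for an unpaired compensator, and
`4 d 0 / √2 ≤ 3 d 0` for the initial norm `2 d 0` of the pairs at the next scale. -/
theorem dyadic_maximal {Ω : Type*} {m0 : MeasurableSpace Ω} {P : Measure Ω}
    [IsProbabilityMeasure P] (m : ℕ) : ∀ (F : Filtration ℕ m0) (Z : ℕ → Ω → ℝ) (c : ℝ) (d : ℕ → ℝ),
    (∀ i, MemLp (Z i) 2 P) → (∀ i, Measurable[F (i + 1)] (Z i)) →
    (∀ i, lpNorm (Z i) 2 P ≤ c) →
    (∀ l i, lpNorm (P[∑ t ∈ Finset.Ico (i * 2 ^ l) ((i + 1) * 2 ^ l), Z t | F (i * 2 ^ l)]) 2 P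
      ≤ d l) →
    ∃ g : Ω → ℝ, MemLp g 2 P ∧
      lpNorm g 2 P ≤ √2 ^ m * (2 * c + 6 * ∑ l ∈ Finset.range m, d l / √2 ^ l) ∧
      ∀ ω, ∀ j ≤ 2 ^ m, |∑ i ∈ Finset.range j, Z i ω| ≤ g ω := by
  induction m with
  | zero =>
    intro F Z c d hZ hZF hc hd
    refine ⟨fun ω => |Z 0 ω|, (hZ 0).abs, ?_, fun ω j hj => ?_⟩
    · have h0 : 0 ≤ lpNorm (Z 0) 2 P := lpNorm_nonneg
      have := hc 0
      rw [lpNorm_fun_abs (hZ 0).1]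
      simp
      linarith
    · have : j = 0 ∨ j = 1 := by simp at hj; omega
      rcases this with rfl | rfl <;> simp
  | succ m ih =>
    intro F Z c d hZ hZF hc hd
    set R : ℕ → Ω → ℝ := fun i => P[Z i | F i] with hR
    have hR2 : ∀ i, MemLp (R i) 2 P := fun i => (hZ i).condExp (by norm_num)
    have hRF : ∀ i, Measurable[F i] (R i) := fun i => stronglyMeasurable_condExp.measurable
    have hRd : ∀ i, lpNorm (R i) 2 P ≤ d 0 := fun i => by simpa using hd 0 i
    have hd0 : 0 ≤ d 0 := lpNorm_nonneg.trans (hRd 0)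
    have hc0 : 0 ≤ c := lpNorm_nonneg.trans (hc 0)
    set D : ℕ → Ω → ℝ := fun i => Z i - R i with hD
    have hD2 : ∀ i, MemLp (D i) 2 P := fun i => (hZ i).sub (hR2 i)
    have hDc : ∀ i, lpNorm (D i) 2 P ≤ c + d 0 := fun i =>
      (lpNorm_sub_le (hZ i) (by norm_num)).trans (add_le_add (hc i) (hRd i))
    have hDF : ∀ i, Measurable[F (i + 1)] (D i) := fun i =>
      (hZF i).sub ((hRF i).mono (F.mono (Nat.le_succ i)) le_rfl)
    have horth : ∀ i (U : Ω → ℝ), Measurable[F i] U → MemLp U 2 P →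
        ∫ ω, U ω * D i ω ∂P = 0 := by
      intro i U hU hU2
      have h1 := integral_mul_condExp_eq (F.le i) hU hU2 (hZ i)
      simp only [hD, Pi.sub_apply, mul_sub]
      have hi1 : Integrable (fun ω => U ω * Z i ω) P := hU2.integrable_mul (hZ i)
      have hi2 : Integrable (fun ω => U ω * R i ω) P := hU2.integrable_mul (hR2 i)
      rw [integral_sub hi1 hi2, h1, sub_self]
    -- the compensators are regrouped in pairs, along the filtration of the even times
    let F' : Filtration ℕ m0 :=
      { seq := fun k => F (2 * k)
        mono' := fun i j hij => F.mono (by omega)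
        le' := fun i => F.le _ }
    obtain ⟨g', hg'2, hg'n, hg'⟩ := ih F' (fun k => R (2 * k) + R (2 * k + 1)) (2 * d 0)
      (fun l => d (l + 1)) (fun i => (hR2 _).add (hR2 _))
      (fun i => ((hRF (2 * i)).mono (F.mono (by omega)) le_rfl).add
        ((hRF (2 * i + 1)).mono (F.mono (by omega)) le_rfl))
      (fun i => (lpNorm_add_le (hR2 _) (by norm_num)).trans (by
        linarith [hRd (2 * i), hRd (2 * i + 1)]))
      (fun l i => by
        rw [sum_Ico_two_mul_pair R (Nat.mul_le_mul_right _ (Nat.le_succ i))]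
        have h := condExp_sum_condExp_eq F hZ (2 * (i * 2 ^ l)) (2 * ((i + 1) * 2 ^ l))
        have h2 := hd (l + 1) i
        have e1 : i * 2 ^ (l + 1) = 2 * (i * 2 ^ l) := by ring
        have e2 : (i + 1) * 2 ^ (l + 1) = 2 * ((i + 1) * 2 ^ l) := by ring
        rw [e1, e2] at h2
        exact (lpNorm_congr_ae h).le.trans h2)
    obtain ⟨gM, hgM2, hgMn, hgM⟩ := doob_maximal F hD2 hDF horth (2 ^ (m + 1))
    obtain ⟨hgR2, hgRn⟩ := sum_sq_memLp (P := P) (Finset.range (2 ^ (m + 1))) fun i _ => hR2 i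
    have hs2 : √2 ^ 2 = (2 : ℝ) := Real.sq_sqrt (by norm_num)
    have hspos : 0 < √(2 : ℝ) := by positivity
    have hs : (√2 ^ (m + 1)) ^ 2 = (2 : ℝ) ^ (m + 1) := by rw [← pow_mul, mul_comm, pow_mul, hs2]
    have hMn : lpNorm gM 2 P ≤ √2 ^ (m + 1) * (2 * (c + d 0)) := by
      refine abs_le_of_sq_le_sq' ?_ (by positivity) |>.2
      refine hgMn.trans ?_
      calc 4 * ∑ i ∈ Finset.range (2 ^ (m + 1)), lpNorm (D i) 2 P ^ 2
          ≤ 4 * ∑ i ∈ Finset.range (2 ^ (m + 1)), (c + d 0) ^ 2 := by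
            gcongr with i hi
            · exact lpNorm_nonneg
            · exact hDc i
        _ = (√2 ^ (m + 1) * (2 * (c + d 0))) ^ 2 := by
            rw [mul_pow, hs]
            simp
            ring
    have hRn : lpNorm (fun ω => √(∑ i ∈ Finset.range (2 ^ (m + 1)), R i ω ^ 2)) 2 P ≤
        √2 ^ (m + 1) * d 0 := by
      refine abs_le_of_sq_le_sq' ?_ (by positivity) |>.2
      rw [hgRn]
      calc ∑ i ∈ Finset.range (2 ^ (m + 1)), lpNorm (R i) 2 P ^ 2
          ≤ ∑ i ∈ Finset.range (2 ^ (m + 1)), (d 0) ^ 2 := by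
            gcongr with i hi
            · exact lpNorm_nonneg
            · exact hRd i
        _ = (√2 ^ (m + 1) * d 0) ^ 2 := by
            rw [mul_pow, hs]
            simp
    refine ⟨gM + (fun ω => √(∑ i ∈ Finset.range (2 ^ (m + 1)), R i ω ^ 2)) + g',
      (hgM2.add hgR2).add hg'2, ?_, fun ω j hj => ?_⟩
    · refine (lpNorm_add_le (hgM2.add hgR2) (by norm_num)).trans ?_
      refine (add_le_add ((lpNorm_add_le hgM2 (by norm_num)).trans (add_le_add hMn hRn))
        hg'n).trans ?_
      have hsum : √2 ^ (m + 1) * ∑ l ∈ Finset.range (m + 1), d l / √2 ^ l =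
          √2 ^ m * ∑ l ∈ Finset.range m, d (l + 1) / √2 ^ l + √2 ^ (m + 1) * d 0 := by
        rw [Finset.sum_range_succ', mul_add, pow_zero, div_one, Finset.mul_sum, Finset.mul_sum]
        congr 1
        refine Finset.sum_congr rfl fun l _ => ?_
        field_simp
        ring
      have h43 : √2 ^ m * (4 * d 0) ≤ √2 ^ (m + 1) * (3 * d 0) := by
        have h1 : (4 : ℝ) / 3 ≤ √2 := Real.le_sqrt_of_sq_le (by norm_num)
        have h2 : 0 ≤ √2 ^ m * d 0 := by positivity
        rw [pow_succ]
        nlinarith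
      have e : √2 ^ (m + 1) * (2 * c + 6 * ∑ l ∈ Finset.range (m + 1), d l / √2 ^ l) =
          √2 ^ (m + 1) * (2 * c) + 6 * (√2 ^ (m + 1) * ∑ l ∈ Finset.range (m + 1), d l / √2 ^ l) := by
        ring
      rw [e, hsum]
      linarith
    · -- a partial sum splits into a martingale, paired compensators, and at most one more
      have hsplit : ∑ i ∈ Finset.range j, Z i ω =
          ∑ i ∈ Finset.range j, D i ω + ∑ i ∈ Finset.range j, R i ω := by
        rw [← Finset.sum_add_distrib]
        exact Finset.sum_congr rfl fun i _ => by simp [hD]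
      have hRabs : ∀ i < 2 ^ (m + 1), |R i ω| ≤ √(∑ i ∈ Finset.range (2 ^ (m + 1)), R i ω ^ 2) := by
        intro i hi
        refine Real.abs_le_sqrt ?_
        exact Finset.single_le_sum (f := fun i => R i ω ^ 2) (fun _ _ => sq_nonneg _)
          (Finset.mem_range.2 hi)
      have hpair : ∀ q ≤ 2 ^ m, |∑ i ∈ Finset.range (2 * q), R i ω| ≤ g' ω := by
        intro q hq
        rw [← sum_range_two_mul_pair]
        exact hg' ω q hq
      have hRsum : |∑ i ∈ Finset.range j, R i ω| ≤
          √(∑ i ∈ Finset.range (2 ^ (m + 1)), R i ω ^ 2) + g' ω := by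
        rw [pow_succ] at hj
        rcases Nat.even_or_odd' j with ⟨q, rfl | rfl⟩
        · exact (hpair q (by omega)).trans (le_add_of_nonneg_left (Real.sqrt_nonneg _))
        · rw [Finset.sum_range_succ, add_comm]
          refine (abs_add_le _ _).trans (add_le_add (hRabs _ ?_) (hpair q (by omega)))
          rw [pow_succ]
          omega
      rw [hsplit]
      refine (abs_add_le _ _).trans ?_
      have := hgM ω j hj
      simp only [Pi.add_apply]
      linarith

/-! ### The maximal inequality under a mixing bound -/

/-- The sums of the `Y i` with `i ≥ j + n` have correlation at most `ρ n` with `L²(F j)`. This is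
the only form in which mixing enters the maximal inequality. In its uses `Y i` is measurable with
respect to `F (i + 1)`, so that `ρ n` belongs to the variables `Y i`, `i < j`, and `Y i`,
`i ≥ j + n`. -/
def MixingBound {Ω : Type*} {m0 : MeasurableSpace Ω} (P : Measure Ω) (F : Filtration ℕ m0)
    (Y : ℕ → Ω → ℝ) (ρ : ℕ → ℝ) : Prop :=
  ∀ (j n b : ℕ) (U : Ω → ℝ), Measurable[F j] U → MemLp U 2 P →
    |∫ ω, U ω * (∑ i ∈ Finset.Ico (j + n) b, Y i) ω ∂P| ≤
      ρ n * (lpNorm U 2 P * lpNorm (∑ i ∈ Finset.Ico (j + n) b, Y i) 2 P)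

/-- The gap `⌊2 ^ (l / 3)⌋` left between neighbouring blocks of length `2 ^ l`: short compared
with `2 ^ (l / 2)`, so that the discarded terms are negligible. -/
noncomputable def gapLength (l : ℕ) : ℕ := ⌊(2 : ℝ) ^ ((l : ℝ) / 3)⌋₊

theorem gapLength_le_two_pow (l : ℕ) : gapLength l ≤ 2 ^ l := by
  refine Nat.floor_le_of_le ?_
  rw [Nat.cast_pow, Nat.cast_ofNat, ← Real.rpow_natCast]
  exact Real.rpow_le_rpow_of_exponent_le (by norm_num)
    (by have : (0 : ℝ) ≤ l := l.cast_nonneg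
        linarith)

theorem gapLength_le (l : ℕ) : (gapLength l : ℝ) ≤ √2 ^ l * ((2 : ℝ) ^ (-(1 / 6) : ℝ)) ^ l := by
  refine (Nat.floor_le (by positivity)).trans (le_of_eq ?_)
  rw [← mul_pow, Real.sqrt_eq_rpow, ← Real.rpow_add (by norm_num), ← Real.rpow_natCast,
    ← Real.rpow_mul (by norm_num)]
  congr 1
  ring

theorem two_rpow_lt_one : (2 : ℝ) ^ (-(1 / 6) : ℝ) < 1 :=
  Real.rpow_lt_one_of_one_lt_of_neg (by norm_num) (by norm_num)

/-- Covariance of a block with its past: the first `p` terms are bounded trivially, the others by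
mixing with gap `p`. -/
theorem MixingBound.abs_integral_mul_sum_le {Ω : Type*} {m0 : MeasurableSpace Ω} {P : Measure Ω}
    {F : Filtration ℕ m0} {Y : ℕ → Ω → ℝ} {ρ : ℕ → ℝ} (hmix : MixingBound P F Y ρ)
    (hρ0 : ∀ n, 0 ≤ ρ n) (hρ1 : ∀ n, ρ n ≤ 1) (hY : ∀ i, MemLp (Y i) 2 P) {σ : ℝ}
    (hσ : ∀ i, lpNorm (Y i) 2 P ≤ σ) {a N p : ℕ} (hp : p ≤ N) {U : Ω → ℝ}
    (hU : Measurable[F a] U) (hU2 : MemLp U 2 P) :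
    |∫ ω, U ω * (∑ i ∈ Finset.Ico a (a + N), Y i) ω ∂P| ≤
      lpNorm U 2 P * (2 * p * σ + ρ p * lpNorm (∑ i ∈ Finset.Ico a (a + N), Y i) 2 P) := by
  set B := ∑ i ∈ Finset.Ico a (a + N), Y i with hB
  set B1 := ∑ i ∈ Finset.Ico a (a + p), Y i with hB1
  set B2 := ∑ i ∈ Finset.Ico (a + p) (a + N), Y i with hB2
  have hsplit : B = B1 + B2 :=
    (Finset.sum_Ico_consecutive _ (by omega) (by omega)).symm
  have h1 : MemLp B1 2 P := memLp_finsetSum' _ fun i _ => hY i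
  have h2 : MemLp B2 2 P := memLp_finsetSum' _ fun i _ => hY i
  have hσ0 : 0 ≤ σ := lpNorm_nonneg.trans (hσ 0)
  have hn1 : lpNorm B1 2 P ≤ p * σ := by
    refine (lpNorm_sum_le (fun i _ => hY i) (by norm_num)).trans ?_
    refine (Finset.sum_le_sum fun i _ => hσ i).trans (le_of_eq ?_)
    simp
  have hn2 : lpNorm B2 2 P ≤ lpNorm B 2 P + p * σ := by
    have e : B2 = B - B1 := by rw [hsplit]; abel
    have hB2' : MemLp B 2 P := by rw [hsplit]; exact h1.add h2
    rw [e]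
    exact (lpNorm_sub_le hB2' (by norm_num)).trans (by linarith)
  have hi1 : Integrable (fun ω => U ω * B1 ω) P := hU2.integrable_mul h1
  have hi2 : Integrable (fun ω => U ω * B2 ω) P := hU2.integrable_mul h2
  have he : ∫ ω, U ω * B ω ∂P = ∫ ω, U ω * B1 ω ∂P + ∫ ω, U ω * B2 ω ∂P := by
    rw [← integral_add hi1 hi2]
    simp [hsplit, mul_add]
  rw [he]
  refine (abs_add_le _ _).trans ?_
  have hU0 : 0 ≤ lpNorm U 2 P := lpNorm_nonneg
  have b1 := (abs_integral_mul_le_lpNorm hU2 h1).trans (mul_le_mul_of_nonneg_left hn1 hU0)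
  have b2 : _ ≤ ρ p * (lpNorm U 2 P * lpNorm B2 2 P) := hmix a p (a + N) U hU hU2
  have b3 : ρ p * (lpNorm U 2 P * lpNorm B2 2 P) ≤
      lpNorm U 2 P * (ρ p * lpNorm B 2 P + p * σ) := by
    have hpσ : 0 ≤ p * σ := by positivity
    calc ρ p * (lpNorm U 2 P * lpNorm B2 2 P)
        ≤ ρ p * (lpNorm U 2 P * (lpNorm B 2 P + p * σ)) := by gcongr; exact hρ0 p
      _ = lpNorm U 2 P * (ρ p * lpNorm B 2 P + ρ p * (p * σ)) := by ring
      _ ≤ lpNorm U 2 P * (ρ p * lpNorm B 2 P + p * σ) := by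
        refine mul_le_mul_of_nonneg_left ?_ hU0
        linarith [mul_le_of_le_one_left hpσ (hρ1 p)]
  linarith

/-- The variance of a sum of `2 ^ l` consecutive terms grows linearly in `2 ^ l`, up to a product
that converges when `ρ (gapLength t)` is summable. -/
theorem MixingBound.lpNorm_dyadic_sum_le {Ω : Type*} {m0 : MeasurableSpace Ω} {P : Measure Ω}
    {F : Filtration ℕ m0} {Y : ℕ → Ω → ℝ} {ρ : ℕ → ℝ} (hmix : MixingBound P F Y ρ)
    (hρ0 : ∀ n, 0 ≤ ρ n) (hρ1 : ∀ n, ρ n ≤ 1) (hY : ∀ i, MemLp (Y i) 2 P)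
    (hYF : ∀ i, Measurable[F (i + 1)] (Y i)) {σ : ℝ} (hσ : ∀ i, lpNorm (Y i) 2 P ≤ σ) (l a : ℕ) :
    lpNorm (∑ i ∈ Finset.Ico a (a + 2 ^ l), Y i) 2 P ≤ √2 ^ l * (σ *
      √(∏ t ∈ Finset.range l, (1 + (ρ (gapLength t) + 2 * ((2 : ℝ) ^ (-(1 / 6) : ℝ)) ^ t)))) := by
  set q : ℝ := (2 : ℝ) ^ (-(1 / 6) : ℝ) with hq
  have hq0 : 0 < q := by positivity
  have hσ0 : 0 ≤ σ := lpNorm_nonneg.trans (hσ 0)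
  induction l generalizing a with
  | zero => simpa using hσ a
  | succ l ih =>
    set κ := ∏ t ∈ Finset.range l, (1 + (ρ (gapLength t) + 2 * q ^ t)) with hκ
    have hκ1 : 1 ≤ κ := by
      refine Finset.prod_induction _ (fun x : ℝ => 1 ≤ x)
        (fun _ _ => one_le_mul_of_one_le_of_one_le) le_rfl ?_
      intro t _
      have := hρ0 (gapLength t)
      have : 0 < q ^ t := by positivity
      linarith
    set v := √2 ^ l * (σ * √κ) with hv
    have hv0 : 0 ≤ v := by positivity
    have hs : √κ ^ 2 = κ := Real.sq_sqrt (by linarith)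
    have hs2 : √2 ^ 2 = (2 : ℝ) := Real.sq_sqrt (by norm_num)
    set A := ∑ i ∈ Finset.Ico a (a + 2 ^ l), Y i with hA
    set B := ∑ i ∈ Finset.Ico (a + 2 ^ l) (a + 2 ^ l + 2 ^ l), Y i with hB
    have hA2 : MemLp A 2 P := memLp_finsetSum' _ fun i _ => hY i
    have hB2 : MemLp B 2 P := memLp_finsetSum' _ fun i _ => hY i
    have hAF : Measurable[F (a + 2 ^ l)] A := by
      have e : A = fun ω => ∑ i ∈ Finset.Ico a (a + 2 ^ l), Y i ω := by
        ext ω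
        simp [hA]
      rw [e]
      exact Finset.measurable_fun_sum _ fun i hi =>
        (hYF i).mono (F.mono (Finset.mem_Ico.1 hi).2) le_rfl
    have hAB : ∑ i ∈ Finset.Ico a (a + 2 ^ (l + 1)), Y i = A + B := by
      rw [hA, hB, Finset.sum_Ico_consecutive _ (Nat.le_add_right _ _) (Nat.le_add_right _ _),
        pow_succ, mul_two, add_assoc]
    have hAv : lpNorm A 2 P ≤ v := ih a
    have hBv : lpNorm B 2 P ≤ v := ih (a + 2 ^ l)
    have hcov := hmix.abs_integral_mul_sum_le hρ0 hρ1 hY hσ (gapLength_le_two_pow l) hAF hA2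
    rw [← hB] at hcov
    have hgap : (gapLength l : ℝ) * σ ≤ q ^ l * v := by
      have h1 : (1 : ℝ) ≤ √κ := Real.one_le_sqrt.2 hκ1
      calc (gapLength l : ℝ) * σ ≤ (√2 ^ l * q ^ l) * σ := by
            gcongr
            exact gapLength_le l
        _ = q ^ l * (√2 ^ l * (σ * 1)) := by ring
        _ ≤ q ^ l * v := by rw [hv]; gcongr
    have hcov2 : ∫ ω, A ω * B ω ∂P ≤ v * (2 * (q ^ l * v) + ρ (gapLength l) * v) := by
      refine (le_abs_self _).trans (hcov.trans ?_)
      have hr := hρ0 (gapLength l)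
      have hB0 : 0 ≤ lpNorm B 2 P := lpNorm_nonneg
      refine mul_le_mul hAv ?_ (by positivity) hv0
      have := mul_le_mul_of_nonneg_left hBv hr
      linarith
    have hsq : lpNorm (A + B) 2 P ^ 2 =
        lpNorm A 2 P ^ 2 + 2 * ∫ ω, A ω * B ω ∂P + lpNorm B 2 P ^ 2 := by
      have hi : Integrable (fun ω => A ω * B ω) P := hA2.integrable_mul hB2
      have hi2 : Integrable (fun ω => A ω ^ 2 + 2 * (A ω * B ω)) P :=
        hA2.integrable_sq.add (hi.const_mul 2)
      rw [lpNorm_two_sq (hA2.add hB2).1, lpNorm_two_sq hA2.1, lpNorm_two_sq hB2.1,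
        ← integral_const_mul, ← integral_add hA2.integrable_sq (hi.const_mul 2),
        ← integral_add hi2 hB2.integrable_sq]
      congr 1
      ext ω
      simp only [Pi.add_apply]
      ring
    rw [hAB]
    refine abs_le_of_sq_le_sq' ?_ (by positivity) |>.2
    rw [Finset.prod_range_succ, ← hκ, mul_pow, mul_pow, Real.sq_sqrt, hsq, pow_succ (√2) l, mul_pow, hs2]
    · have hA3 : lpNorm A 2 P ^ 2 ≤ v ^ 2 := by gcongr; exact lpNorm_nonneg
      have hB3 : lpNorm B 2 P ^ 2 ≤ v ^ 2 := by gcongr; exact lpNorm_nonneg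
      have e : (√2 ^ l) ^ 2 * 2 * (σ ^ 2 * (κ * (1 + (ρ (gapLength l) + 2 * q ^ l)))) =
          2 * v ^ 2 * (1 + (ρ (gapLength l) + 2 * q ^ l)) := by
        rw [hv, mul_pow, mul_pow, hs]
        ring
      rw [e]
      nlinarith
    · have hql : 0 ≤ q ^ l := pow_nonneg hq0.le l
      exact mul_nonneg (zero_le_one.trans hκ1) (by linarith [hρ0 (gapLength l)])

/-- `C` is a constant for the `L²` maximal inequality, valid for all adapted sequences with mixing
bound `ρ`. The maximum of the partial sums is represented by a dominating function `g`. -/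
def IsMaximalConstant {Ω : Type*} {m0 : MeasurableSpace Ω} (P : Measure Ω) (ρ : ℕ → ℝ) (C : ℝ) :
    Prop :=
  ∀ (F : Filtration ℕ m0) (Y : ℕ → Ω → ℝ) (σ : ℝ), MixingBound P F Y ρ →
    (∀ i, MemLp (Y i) 2 P) → (∀ i, Measurable[F (i + 1)] (Y i)) →
    (∀ i, lpNorm (Y i) 2 P ≤ σ) → ∀ N : ℕ, 0 < N →
    ∃ g : Ω → ℝ, MemLp g 2 P ∧ lpNorm g 2 P ^ 2 ≤ C * N * σ ^ 2 ∧
      ∀ ω, ∀ j ≤ N, |∑ i ∈ Finset.range j, Y i ω| ≤ g ω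

theorem exists_isMaximalConstant {Ω : Type*} {m0 : MeasurableSpace Ω} (P : Measure Ω)
    [IsProbabilityMeasure P] {ρ : ℕ → ℝ} (hρ0 : ∀ n, 0 ≤ ρ n) (hρ1 : ∀ n, ρ n ≤ 1)
    (hsum : Summable fun l => ρ (gapLength l)) : ∃ C : ℝ, 0 ≤ C ∧ IsMaximalConstant P ρ C := by
  set q : ℝ := (2 : ℝ) ^ (-(1 / 6) : ℝ) with hq
  have hq0 : 0 < q := by positivity
  have hqs : Summable fun l : ℕ => q ^ l := summable_geometric_of_lt_one hq0.le two_rpow_lt_one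
  set S : ℝ := ∑' t, (ρ (gapLength t) + 2 * q ^ t) with hS
  have hsumS : Summable fun t => ρ (gapLength t) + 2 * q ^ t := hsum.add (hqs.mul_left 2)
  have hnn : ∀ t, 0 ≤ ρ (gapLength t) + 2 * q ^ t := fun t => by
    have := hρ0 (gapLength t)
    positivity
  set κ := √(Real.exp S) with hκ
  have hprod : ∀ l, √(∏ t ∈ Finset.range l, (1 + (ρ (gapLength t) + 2 * q ^ t))) ≤ κ := by
    intro l
    refine Real.sqrt_le_sqrt ?_
    refine (Finset.prod_le_prod (fun t _ => by linarith [hnn t])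
      fun t _ => (by rw [add_comm]; exact Real.add_one_le_exp _ :
        1 + (ρ (gapLength t) + 2 * q ^ t) ≤ Real.exp (ρ (gapLength t) + 2 * q ^ t))).trans ?_
    rw [← Real.exp_sum]
    exact Real.exp_le_exp.2 (hsumS.sum_le_tsum _ fun t _ => hnn t)
  have hκ0 : 0 ≤ κ := Real.sqrt_nonneg _
  have hsumT : Summable fun t => 2 * q ^ t + ρ (gapLength t) * κ :=
    (hqs.mul_left 2).add (hsum.mul_right κ)
  set T : ℝ := ∑' t, (2 * q ^ t + ρ (gapLength t) * κ) with hT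
  have hTnn : ∀ t, 0 ≤ 2 * q ^ t + ρ (gapLength t) * κ := fun t => by
    have := hρ0 (gapLength t)
    positivity
  have hT0 : 0 ≤ T := tsum_nonneg hTnn
  refine ⟨2 * (2 + 6 * T) ^ 2, by positivity, ?_⟩
  intro F Y σ hmix hY hYF hσ N hN
  have hσ0 : 0 ≤ σ := lpNorm_nonneg.trans (hσ 0)
  set m := Nat.log 2 N + 1 with hm
  have hNm : N ≤ 2 ^ m := (Nat.lt_pow_succ_log_self (by norm_num) N).le
  have hmN : 2 ^ m ≤ 2 * N := by
    rw [hm, pow_succ, mul_comm]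
    exact Nat.mul_le_mul_left 2 (Nat.pow_log_le_self 2 hN.ne')
  obtain ⟨g, hg2, hgn, hg⟩ := dyadic_maximal (P := P) m F Y σ
    (fun l => √2 ^ l * (σ * (2 * q ^ l + ρ (gapLength l) * κ))) hY hYF hσ (by
      intro l i
      set a := i * 2 ^ l with ha
      have e : (i + 1) * 2 ^ l = a + 2 ^ l := by rw [ha]; ring
      rw [e]
      set B := ∑ i ∈ Finset.Ico a (a + 2 ^ l), Y i with hB
      have hB2 : MemLp B 2 P := memLp_finsetSum' _ fun i _ => hY i
      set R := P[B | F a] with hR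
      have hR2 : MemLp R 2 P := hB2.condExp (by norm_num)
      have hRF : Measurable[F a] R := stronglyMeasurable_condExp.measurable
      have h1 : lpNorm R 2 P ^ 2 = ∫ ω, R ω * B ω ∂P := by
        rw [lpNorm_two_sq hR2.1, ← integral_mul_condExp_eq (F.le a) hRF hR2 hB2]
        simp [← hR, pow_two]
      have hcov := hmix.abs_integral_mul_sum_le hρ0 hρ1 hY hσ (gapLength_le_two_pow l) hRF hR2
      rw [← hB, ← h1, abs_of_nonneg (sq_nonneg _), pow_two] at hcov
      have hle : lpNorm R 2 P ≤ 2 * gapLength l * σ + ρ (gapLength l) * lpNorm B 2 P := by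
        rcases (lpNorm_nonneg (f := R) (p := 2) (μ := P)).eq_or_lt with h | h
        · rw [← h]
          have := hρ0 (gapLength l)
          have : 0 ≤ lpNorm B 2 P := lpNorm_nonneg
          positivity
        · exact le_of_mul_le_mul_left hcov h
      refine hle.trans ?_
      have hBn : lpNorm B 2 P ≤ √2 ^ l * (σ * κ) :=
        (hmix.lpNorm_dyadic_sum_le hρ0 hρ1 hY hYF hσ l a).trans (by gcongr; exact hprod l)
      have h2 := gapLength_le l
      have h3 := mul_le_mul_of_nonneg_left hBn (hρ0 (gapLength l))
      have h4 := mul_le_mul_of_nonneg_right h2 hσ0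
      have e2 : √2 ^ l * (σ * (2 * q ^ l + ρ (gapLength l) * κ)) =
        2 * (√2 ^ l * q ^ l * σ) + ρ (gapLength l) * (√2 ^ l * (σ * κ)) := by ring
      rw [e2]
      linarith)
  refine ⟨g, hg2, ?_, fun ω j hj => hg ω j (hj.trans hNm)⟩
  have hsumle : ∑ l ∈ Finset.range m,
      √2 ^ l * (σ * (2 * q ^ l + ρ (gapLength l) * κ)) / √2 ^ l ≤ σ * T := by
    calc _ = σ * ∑ l ∈ Finset.range m, (2 * q ^ l + ρ (gapLength l) * κ) := by
          rw [Finset.mul_sum]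
          refine Finset.sum_congr rfl fun l _ => ?_
          field_simp
      _ ≤ σ * T := by
        gcongr
        exact hsumT.sum_le_tsum _ fun t _ => hTnn t
  have hg1 : lpNorm g 2 P ≤ √2 ^ m * (σ * (2 + 6 * T)) := by
    refine hgn.trans ?_
    gcongr
    linarith
  have hs : (√2 ^ m) ^ 2 = (2 : ℝ) ^ m := by
    rw [← pow_mul, mul_comm, pow_mul, Real.sq_sqrt (by norm_num)]
  calc lpNorm g 2 P ^ 2 ≤ (√2 ^ m * (σ * (2 + 6 * T))) ^ 2 := by
        gcongr
        exact lpNorm_nonneg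
    _ = (2 : ℝ) ^ m * (σ * (2 + 6 * T)) ^ 2 := by rw [mul_pow, hs]
    _ ≤ (2 * N) * (σ * (2 + 6 * T)) ^ 2 := by
        gcongr
        exact_mod_cast hmN
    _ = 2 * (2 + 6 * T) ^ 2 * N * σ ^ 2 := by ring

/-! ### From `ρ`-mixing to the mixing bound -/

theorem lpNorm_sub_integral_le {Ω : Type*} {m0 : MeasurableSpace Ω} {P : Measure Ω}
    [IsProbabilityMeasure P] {U : Ω → ℝ} (hU : MemLp U 2 P) :
    lpNorm (fun ω => U ω - ∫ ω', U ω' ∂P) 2 P ≤ lpNorm U 2 P := by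
  have hc : MemLp (fun _ : Ω => ∫ ω, U ω ∂P) 2 P := memLp_const _
  have hUi := hU.integrable (by norm_num)
  refine abs_le_of_sq_le_sq' ?_ lpNorm_nonneg |>.2
  have hm : MemLp (fun ω => U ω - ∫ ω', U ω' ∂P) 2 P := hU.sub hc
  rw [lpNorm_two_sq hm.1, lpNorm_two_sq hU.1]
  have e : ∀ ω, (U ω - ∫ ω', U ω' ∂P) ^ 2 =
      U ω ^ 2 - 2 * (∫ ω', U ω' ∂P) * U ω + (∫ ω', U ω' ∂P) ^ 2 := fun ω => by ring
  have hi : Integrable (fun ω => U ω ^ 2 - 2 * (∫ ω', U ω' ∂P) * U ω) P :=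
    hU.integrable_sq.sub (hUi.const_mul _)
  simp_rw [e]
  rw [integral_add hi (integrable_const _), integral_sub hU.integrable_sq (hUi.const_mul _),
    integral_const_mul]
  simp
  nlinarith [sq_nonneg (∫ ω', U ω' ∂P)]

theorem abs_cov_le_lpNorm_mul {Ω : Type*} {m0 : MeasurableSpace Ω} {P : Measure Ω}
    [IsProbabilityMeasure P] {U V : Ω → ℝ} (hU : MemLp U 2 P) (hV : MemLp V 2 P) :
    |∫ ω, U ω * V ω ∂P - (∫ ω, U ω ∂P) * ∫ ω, V ω ∂P| ≤ lpNorm U 2 P * lpNorm V 2 P := by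
  have h1 := (hV.integrable (by norm_num)).const_mul (∫ ω, U ω ∂P)
  have hi : Integrable (fun ω => U ω * V ω) P := hU.integrable_mul hV
  have hc : MemLp (fun _ : Ω => ∫ ω, U ω ∂P) 2 P := memLp_const _
  have e : ∫ ω, U ω * V ω ∂P - (∫ ω, U ω ∂P) * ∫ ω, V ω ∂P =
      ∫ ω, (U ω - ∫ ω', U ω' ∂P) * V ω ∂P := by
    rw [← integral_const_mul, ← integral_sub hi h1]
    congr 1
    ext ω
    ring
  rw [e]
  refine (abs_integral_mul_le_lpNorm (hU.sub hc) hV).trans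
    (mul_le_mul_of_nonneg_right ?_ lpNorm_nonneg)
  exact lpNorm_sub_integral_le hU

/-- By the Cauchy–Schwarz inequality the set in the definition of `rhoCoeff` is bounded, so that its
`sSup` is a genuine supremum. -/
theorem rhoCoeff_set_le_one {Ω : Type*} (𝒜 ℬ : MeasurableSpace Ω) [MeasurableSpace Ω]
    (P : Measure Ω) [IsProbabilityMeasure P] :
    ∀ c ∈ {c : ℝ | ∃ U V : Ω → ℝ,
      Measurable[𝒜] U ∧ MemLp U 2 P ∧ Measurable[ℬ] V ∧ MemLp V 2 P ∧
      c = |(∫ ω, U ω * V ω ∂P) - (∫ ω, U ω ∂P) * (∫ ω, V ω ∂P)| /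
        √((∫ ω, U ω ^ 2 ∂P) * (∫ ω, V ω ^ 2 ∂P))}, c ≤ 1 := by
  rintro c ⟨U, V, -, hU, -, hV, rfl⟩
  refine div_le_one_of_le₀ ?_ (Real.sqrt_nonneg _)
  rw [Real.sqrt_mul (integral_nonneg fun _ => sq_nonneg _), ← lpNorm_two_eq_sqrt hU.1,
    ← lpNorm_two_eq_sqrt hV.1]
  exact abs_cov_le_lpNorm_mul hU hV

theorem rhoCoeff_nonneg {Ω : Type*} (𝒜 ℬ : MeasurableSpace Ω) [MeasurableSpace Ω]
    (P : Measure Ω) : 0 ≤ rhoCoeff P 𝒜 ℬ := by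
  refine Real.sSup_nonneg ?_
  rintro c ⟨U, V, -, -, -, -, rfl⟩
  positivity

theorem rhoCoeff_le_one {Ω : Type*} (𝒜 ℬ : MeasurableSpace Ω) [MeasurableSpace Ω]
    (P : Measure Ω) [IsProbabilityMeasure P] : rhoCoeff P 𝒜 ℬ ≤ 1 :=
  Real.sSup_le (rhoCoeff_set_le_one 𝒜 ℬ P) zero_le_one

theorem abs_cov_le_rhoCoeff {Ω : Type*} {𝒜 ℬ : MeasurableSpace Ω} [MeasurableSpace Ω]
    {P : Measure Ω} [IsProbabilityMeasure P] {U V : Ω → ℝ} (hUm : Measurable[𝒜] U)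
    (hU : MemLp U 2 P) (hVm : Measurable[ℬ] V) (hV : MemLp V 2 P) :
    |∫ ω, U ω * V ω ∂P - (∫ ω, U ω ∂P) * ∫ ω, V ω ∂P| ≤
      rhoCoeff P 𝒜 ℬ * (lpNorm U 2 P * lpNorm V 2 P) := by
  have h := le_csSup ⟨1, rhoCoeff_set_le_one 𝒜 ℬ P⟩ ⟨U, V, hUm, hU, hVm, hV, rfl⟩
  rw [Real.sqrt_mul (integral_nonneg fun _ => sq_nonneg _), ← lpNorm_two_eq_sqrt hU.1,
    ← lpNorm_two_eq_sqrt hV.1] at h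
  -- if the denominator vanishes then so does the covariance, by the Cauchy–Schwarz inequality
  rcases (mul_nonneg (lpNorm_nonneg (f := U) (p := 2) (μ := P))
    (lpNorm_nonneg (f := V) (p := 2) (μ := P))).eq_or_lt with h0 | h0
  · have := abs_cov_le_lpNorm_mul hU hV
    rw [← h0] at this ⊢
    simpa using this
  · exact (div_le_iff₀ h0).1 h

theorem rhoMixing_nonneg {Ω : Type*} [MeasurableSpace Ω] (P : Measure Ω) (X : ℤ → Ω → ℝ) (n : ℕ) :
    0 ≤ rhoMixing P X n :=
  Real.iSup_nonneg fun _ => rhoCoeff_nonneg _ _ P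

theorem rhoMixing_le_one {Ω : Type*} [MeasurableSpace Ω] (P : Measure Ω) [IsProbabilityMeasure P]
    (X : ℤ → Ω → ℝ) (n : ℕ) : rhoMixing P X n ≤ 1 :=
  ciSup_le fun _ => rhoCoeff_le_one _ _ P

theorem rhoCoeff_le_rhoMixing {Ω : Type*} [MeasurableSpace Ω] (P : Measure Ω)
    [IsProbabilityMeasure P] (X : ℤ → Ω → ℝ) (n : ℕ) (j : ℤ) :
    rhoCoeff P (sigmaField X (Set.Iic j)) (sigmaField X (Set.Ici (j + n))) ≤ rhoMixing P X n :=
  le_ciSup (f := fun j : ℤ => rhoCoeff P (sigmaField X (Set.Iic j)) (sigmaField X (Set.Ici (j + n))))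
    ⟨1, by rintro _ ⟨j, rfl⟩; exact rhoCoeff_le_one _ _ P⟩ j

theorem sigmaField_mono {Ω : Type*} (X : ℤ → Ω → ℝ) {I J : Set ℤ} (h : I ⊆ J) :
    sigmaField X I ≤ sigmaField X J :=
  biSup_mono h

theorem sigmaField_le {Ω : Type*} [m0 : MeasurableSpace Ω] {X : ℤ → Ω → ℝ}
    (hX : ∀ n, Measurable (X n)) (I : Set ℤ) : sigmaField X I ≤ m0 :=
  iSup₂_le fun i _ => (hX i).comap_le

theorem measurable_sigmaField {Ω : Type*} (X : ℤ → Ω → ℝ) {I : Set ℤ} {i : ℤ} (hi : i ∈ I) :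
    Measurable[sigmaField X I] (X i) :=
  (comap_measurable (X i)).mono (le_iSup₂_of_le i hi le_rfl) le_rfl

/-- The filtration generated by the variables up to the end of the successive blocks of length
`r`, where the block with index `0` starts at time `o + 1`. -/
def blockFiltration {Ω : Type*} [m0 : MeasurableSpace Ω] {X : ℤ → Ω → ℝ}
    (hX : ∀ n, Measurable (X n)) (o : ℤ) (r : ℕ) : Filtration ℕ m0 where
  seq t := sigmaField X (Set.Iic (o + t * r))
  mono' s t hst := sigmaField_mono X (Set.Iic_subset_Iic.2 (by gcongr))
  le' _ := sigmaField_le hX _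

theorem mixingBound_blockFiltration {Ω : Type*} [m0 : MeasurableSpace Ω] {P : Measure Ω}
    [IsProbabilityMeasure P] {X : ℤ → Ω → ℝ} (hX : ∀ n, Measurable (X n)) (o : ℤ) {r : ℕ}
    (hr : 0 < r) {Y : ℕ → Ω → ℝ} (hY : ∀ i, MemLp (Y i) 2 P) (hY0 : ∀ i, ∫ ω, Y i ω ∂P = 0)
    (hYm : ∀ i : ℕ, Measurable[sigmaField X (Set.Ioc (o + i * r) (o + (i + 1) * r))] (Y i)) :
    MixingBound P (blockFiltration hX o r) Y (rhoMixing P X) := by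
  intro j n b U hU hU2
  have hV2 : MemLp (∑ i ∈ Finset.Ico (j + n) b, Y i) 2 P := memLp_finsetSum' _ fun i _ => hY i
  have hV0 : ∫ ω, (∑ i ∈ Finset.Ico (j + n) b, Y i) ω ∂P = 0 := by
    simp only [Finset.sum_apply]
    rw [integral_finsetSum _ fun i _ => (hY i).integrable (by norm_num)]
    simp [hY0]
  have hVm : Measurable[sigmaField X (Set.Ici (o + j * r + n))]
      (∑ i ∈ Finset.Ico (j + n) b, Y i) := by
    have e : (∑ i ∈ Finset.Ico (j + n) b, Y i) = fun ω => ∑ i ∈ Finset.Ico (j + n) b, Y i ω := by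
      ext ω
      simp
    rw [e]
    refine Finset.measurable_fun_sum _ fun i hi => (hYm i).mono (sigmaField_mono X ?_) le_rfl
    intro t ht
    have h1 : (j : ℤ) + n ≤ i := by exact_mod_cast (Finset.mem_Ico.1 hi).1
    have h2 : o + i * r < t := ht.1
    have hr' : (1 : ℤ) ≤ r := by exact_mod_cast hr
    have hn : (0 : ℤ) ≤ n := by positivity
    simp only [Set.mem_Ici]
    nlinarith
  have h := abs_cov_le_rhoCoeff (P := P) hU hU2 hVm hV2
  rw [hV0, mul_zero, sub_zero] at h
  refine h.trans (mul_le_mul_of_nonneg_right (rhoCoeff_le_rhoMixing P X n (o + j * r)) ?_)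
  exact mul_nonneg lpNorm_nonneg lpNorm_nonneg

/-! ### Regularly varying tails -/

theorem truncAt_eq_ite (u x : ℝ) : truncAt u x = if |x| ≤ u then x else 0 := by
  simp [truncAt, Set.indicator_apply]

theorem measurable_truncAt (u : ℝ) : Measurable (truncAt u) :=
  measurable_id.indicator (measurableSet_le continuous_abs.measurable measurable_const)

theorem abs_truncAt_le {u : ℝ} (hu : 0 ≤ u) (x : ℝ) : |truncAt u x| ≤ u := by
  rw [truncAt_eq_ite]
  split_ifs with h
  · exact h
  · simpa using hu

theorem memLp_truncAt {Ω : Type*} [MeasurableSpace Ω] {P : Measure Ω} [IsProbabilityMeasure P]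
    {Y : Ω → ℝ} (hY : Measurable Y) {u : ℝ} (hu : 0 ≤ u) :
    MemLp (fun ω => truncAt u (Y ω)) 2 P :=
  MemLp.of_bound ((measurable_truncAt u).comp hY).aestronglyMeasurable u
    (Eventually.of_forall fun _ => abs_truncAt_le hu _)

/-- A property that holds on `[y₀, 2 y₀]` and passes from `y` to `2 y` holds on `[y₀, ∞)`. -/
theorem doubling_induction {y₀ : ℝ} (hy₀ : 0 < y₀) {p : ℝ → Prop}
    (base : ∀ y, y₀ ≤ y → y ≤ 2 * y₀ → p y) (step : ∀ y, y₀ ≤ y → p y → p (2 * y)) :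
    ∀ y, y₀ ≤ y → p y := by
  have key : ∀ m : ℕ, ∀ y, y₀ ≤ y → y ≤ 2 ^ (m + 1) * y₀ → p y := by
    intro m
    induction m with
    | zero => intro y h1 h2; exact base y h1 (by simpa using h2)
    | succ m ih =>
      intro y h1 h2
      rcases le_total y (2 * y₀) with h | h
      · exact base y h1 h
      · have := step (y / 2) (by linarith) (ih (y / 2) (by linarith) (by
          rw [pow_succ] at h2
          linarith))
        rwa [mul_div_cancel₀ _ (by norm_num : (2 : ℝ) ≠ 0)] at this
  intro y hy
  obtain ⟨m, hm⟩ := pow_unbounded_of_one_lt (y / y₀) (by norm_num : (1 : ℝ) < 2)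
  refine key m y hy ?_
  rw [div_lt_iff₀ hy₀] at hm
  rw [pow_succ]
  nlinarith [pow_pos (by norm_num : (0 : ℝ) < 2) m]

section Tail

variable {Ω : Type*} [MeasurableSpace Ω] {P : Measure Ω} {Y : Ω → ℝ} {α : ℝ}

theorem tail_antitone (P : Measure Ω) [IsProbabilityMeasure P] (Y : Ω → ℝ) :
    Antitone fun x : ℝ => P.real {ω | x < |Y ω|} :=
  fun _ _ h => measureReal_mono fun _ hω => lt_of_le_of_lt h hω

theorem RegularlyVarying.tail_pos [IsProbabilityMeasure P] (h : RegularlyVarying P Y α) (x : ℝ) :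
    0 < P.real {ω | x < |Y ω|} := by
  obtain ⟨L, hL, hG⟩ := h.tail
  obtain ⟨z, hz, hxz, hz0⟩ :=
    (hL.eventually_pos.and ((eventually_ge_atTop x).and (eventually_gt_atTop 0))).exists
  refine lt_of_lt_of_le ?_ (tail_antitone P Y hxz)
  simp only
  rw [hG z hz0]
  positivity

theorem RegularlyVarying.tail_ratio (h : RegularlyVarying P Y α) {c : ℝ} (hc : 0 < c) :
    Tendsto (fun x : ℝ => P.real {ω | c * x < |Y ω|} / P.real {ω | x < |Y ω|}) atTop
      (𝓝 (c ^ (-α))) := by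
  obtain ⟨L, hL, hG⟩ := h.tail
  have h1 := (hL.tendsto_ratio c hc).const_mul (c ^ (-α))
  rw [mul_one] at h1
  refine h1.congr' ?_
  filter_upwards [eventually_gt_atTop 0] with x hx
  rw [hG x hx, hG (c * x) (by positivity), Real.mul_rpow hc.le hx.le]
  have : x ^ (-α) ≠ 0 := (Real.rpow_pos_of_pos hx _).ne'
  rw [mul_assoc, mul_div_assoc, mul_div_mul_left _ _ this]

theorem RegularlyVarying.eventually_tail_le [IsProbabilityMeasure P] (h : RegularlyVarying P Y α) {q : ℝ}
    (hq : (2 : ℝ) ^ (-α) < q) :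
    ∀ᶠ x : ℝ in atTop, P.real {ω | 2 * x < |Y ω|} ≤ q * P.real {ω | x < |Y ω|} := by
  filter_upwards [(h.tail_ratio two_pos).eventually_lt_const hq] with x hx
  exact ((div_lt_iff₀ (h.tail_pos x)).1 hx).le

theorem RegularlyVarying.eventually_le_tail [IsProbabilityMeasure P] (h : RegularlyVarying P Y α) {q : ℝ}
    (hq : q < (2 : ℝ) ^ (-α)) :
    ∀ᶠ x : ℝ in atTop, q * P.real {ω | x < |Y ω|} ≤ P.real {ω | 2 * x < |Y ω|} := by
  filter_upwards [(h.tail_ratio two_pos).eventually_const_lt hq] with x hx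
  exact ((lt_div_iff₀ (h.tail_pos x)).1 hx).le

theorem measurableSet_tail (hY : Measurable Y) (x : ℝ) : MeasurableSet {ω | x < |Y ω|} :=
  measurableSet_lt measurable_const (continuous_abs.measurable.comp hY)

theorem integral_truncAt_doubling [IsProbabilityMeasure P] (hY : Measurable Y) {y : ℝ} (hy : 0 ≤ y) (k : ℕ) (hk : k ≠ 0) :
    ∫ ω, |truncAt (2 * y) (Y ω)| ^ k ∂P ≤
      ∫ ω, |truncAt y (Y ω)| ^ k ∂P + (2 * y) ^ k * P.real {ω | y < |Y ω|} := by
  have hint : ∀ u : ℝ, 0 ≤ u → Integrable (fun ω => |truncAt u (Y ω)| ^ k) P := fun u hu =>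
    Integrable.of_bound (((continuous_abs.measurable.comp
      ((measurable_truncAt u).comp hY)).pow_const k).aestronglyMeasurable) (u ^ k)
      (Eventually.of_forall fun ω => by
        simp only [norm_pow, Real.norm_eq_abs, abs_abs]
        exact pow_le_pow_left₀ (abs_nonneg _) (abs_truncAt_le hu _) k)
  have hset := measurableSet_tail hY y
  have hi2 : Integrable ({ω | y < |Y ω|}.indicator fun _ => (2 * y) ^ k) P :=
    (integrable_const _).indicator hset
  have e : (2 * y) ^ k * P.real {ω | y < |Y ω|} =
      ∫ ω, {ω | y < |Y ω|}.indicator (fun _ => (2 * y) ^ k) ω ∂P := by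
    rw [integral_indicator_const _ hset, smul_eq_mul, mul_comm]
  rw [e, ← integral_add (hint y hy) hi2]
  refine integral_mono (hint _ (by positivity)) ((hint y hy).add hi2) fun ω => ?_
  simp only [truncAt_eq_ite, Set.indicator_apply, Set.mem_ofPred_eq]
  by_cases h1 : |Y ω| ≤ y
  · rw [if_pos h1, if_pos (h1.trans (by linarith)), if_neg (not_lt.2 h1), add_zero]
  · rw [if_neg h1, if_pos (not_le.1 h1)]
    simp only [abs_zero, zero_pow hk, zero_add]
    split_ifs with h2
    · exact pow_le_pow_left₀ (abs_nonneg _) h2 k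
    · simp only [abs_zero, zero_pow hk]
      positivity

theorem integral_truncAt_le [IsProbabilityMeasure P] (Y : Ω → ℝ) {y : ℝ} (hy : 0 ≤ y) (k : ℕ) :
    ∫ ω, |truncAt y (Y ω)| ^ k ∂P ≤ y ^ k := by
  have h : ‖∫ ω, |truncAt y (Y ω)| ^ k ∂P‖ ≤ y ^ k * P.real Set.univ :=
    norm_integral_le_of_norm_le_const (Eventually.of_forall fun ω => by
      simp only [norm_pow, Real.norm_eq_abs, abs_abs]
      exact pow_le_pow_left₀ (abs_nonneg _) (abs_truncAt_le hy _) k)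
  simpa using (le_abs_self _).trans h

theorem RegularlyVarying.exists_truncated_mean_bound [IsProbabilityMeasure P]
    (h : RegularlyVarying P Y α) (hY : Measurable Y) (hα : 1 < α) :
    ∃ M : ℝ, 0 ≤ M ∧ ∀ y, 0 ≤ y → ∫ ω, |truncAt y (Y ω)| ∂P ≤ M := by
  have hq2 : (2 : ℝ) ^ (-α) < 1 / 2 := by
    have := Real.rpow_lt_rpow_of_exponent_lt (by norm_num : (1 : ℝ) < 2) (neg_lt_neg hα)
    rwa [Real.rpow_neg_one, ← one_div] at this
  obtain ⟨q, hq1, hq2⟩ := exists_between hq2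
  obtain ⟨y₁, hG⟩ := eventually_atTop.1 (h.eventually_tail_le hq1)
  set y₀ := max y₁ 1 with hy₀
  have hy0 : 0 < y₀ := lt_max_of_lt_right one_pos
  -- `A` solves `2 + 2 q A = A`, so that `E(|Y| 1{|Y| ≤ y}) + A y P(|Y| > y)` does not increase
  -- under doubling
  set A := 2 / (1 - 2 * q) with hA
  have hA1 : A * (1 - 2 * q) = 2 := div_mul_cancel₀ _ (by linarith)
  have hA0 : 0 < A := div_pos two_pos (by linarith)
  have key := doubling_induction hy0
    (p := fun y => ∫ ω, |truncAt y (Y ω)| ∂P + A * (y * P.real {ω | y < |Y ω|}) ≤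
      2 * y₀ + A * (2 * y₀)) (by
      intro y h1 h2
      have hb := integral_truncAt_le (P := P) Y (hy0.le.trans h1) 1
      simp only [pow_one] at hb
      have hb2 : y * P.real {ω | y < |Y ω|} ≤ 2 * y₀ :=
        (mul_le_of_le_one_right (hy0.le.trans h1) measureReal_le_one).trans h2
      have := mul_le_mul_of_nonneg_left hb2 hA0.le
      linarith) (by
      intro y h1 h2
      have hy : 0 ≤ y := hy0.le.trans h1
      have hb := integral_truncAt_doubling (P := P) hY hy 1 one_ne_zero
      simp only [pow_one] at hb
      have hG' := mul_le_mul_of_nonneg_left (hG y ((le_max_left _ _).trans h1))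
        (by positivity : 0 ≤ A * (2 * y))
      have e : A * (2 * y) * (q * P.real {ω | y < |Y ω|}) + 2 * y * P.real {ω | y < |Y ω|} =
          A * (y * P.real {ω | y < |Y ω|}) := by
        linear_combination (-(y * P.real {ω | y < |Y ω|})) * hA1
      linarith)
  refine ⟨2 * y₀ + A * (2 * y₀), by positivity, fun y hy => ?_⟩
  rcases le_total y₀ y with hle | hle
  · have h1 := key y hle
    have : 0 ≤ A * (y * P.real {ω | y < |Y ω|}) := by positivity
    linarith
  · have hb := integral_truncAt_le (P := P) Y hy 1
    simp only [pow_one] at hb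
    have : 0 ≤ A * (2 * y₀) := by positivity
    linarith

/-- The upper half of Karamata's theorem for the truncated second moment. -/
theorem RegularlyVarying.exists_truncated_moment_bound [IsProbabilityMeasure P]
    (h : RegularlyVarying P Y α) (hY : Measurable Y) (hα : α < 2) :
    ∃ C y₀ : ℝ, 0 ≤ C ∧ 0 < y₀ ∧ ∀ y, y₀ ≤ y →
      ∫ ω, truncAt y (Y ω) ^ 2 ∂P ≤ C * (y ^ 2 * P.real {ω | y < |Y ω|}) := by
  have hq2 : 1 / 4 < (2 : ℝ) ^ (-α) := by
    have := Real.rpow_lt_rpow_of_exponent_lt (by norm_num : (1 : ℝ) < 2) (neg_lt_neg hα)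
    have e : (2 : ℝ) ^ (-2 : ℝ) = 1 / 4 := by
      rw [Real.rpow_neg (by norm_num)]
      norm_num
    rwa [e] at this
  obtain ⟨q, hq1, hq2⟩ := exists_between hq2
  obtain ⟨y₁, hG⟩ := eventually_atTop.1 (h.eventually_le_tail hq2)
  set y₀ := max y₁ 1 with hy₀
  have hy0 : 0 < y₀ := lt_max_of_lt_right one_pos
  -- the first term makes the bound stable under doubling, the second one starts the induction
  set C := max (4 / (4 * q - 1)) (4 * y₀ ^ 2 / (y₀ ^ 2 * P.real {ω | 2 * y₀ < |Y ω|})) with hC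
  have hG0 := h.tail_pos (2 * y₀)
  have hC1 : 4 ≤ C * (4 * q - 1) := (div_le_iff₀ (by linarith)).1 (le_max_left _ _)
  have hC2 : 4 * y₀ ^ 2 ≤ C * (y₀ ^ 2 * P.real {ω | 2 * y₀ < |Y ω|}) :=
    (div_le_iff₀ (by positivity)).1 (le_max_right _ _)
  have hC0 : 0 ≤ C := (div_nonneg (by norm_num) (by linarith)).trans (le_max_left _ _)
  refine ⟨C, y₀, hC0, hy0, doubling_induction hy0 (fun y h1 h2 => ?_) fun y h1 h2 => ?_⟩
  · have hb := integral_truncAt_le (P := P) Y (hy0.le.trans h1) 2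
    simp only [sq_abs] at hb
    have h3 : y ^ 2 ≤ 4 * y₀ ^ 2 := by nlinarith
    refine hb.trans (h3.trans (hC2.trans (mul_le_mul_of_nonneg_left ?_ hC0)))
    exact mul_le_mul (pow_le_pow_left₀ hy0.le h1 2) (tail_antitone P Y h2) hG0.le (sq_nonneg y)
  · have hy : 0 ≤ y := hy0.le.trans h1
    have hb := integral_truncAt_doubling (P := P) hY hy 2 two_ne_zero
    simp only [sq_abs] at hb
    have hG' := mul_le_mul_of_nonneg_left (hG y ((le_max_left _ _).trans h1))
      (by positivity : 0 ≤ C * (2 * y) ^ 2)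
    have h3 := mul_le_mul_of_nonneg_right hC1
      (by positivity : 0 ≤ y ^ 2 * P.real {ω | y < |Y ω|})
    nlinarith

/-- A Potter bound: the tail is eventually at least `c y ^ (-β)` for every `β > α`. -/
theorem RegularlyVarying.exists_tail_lower_bound [IsProbabilityMeasure P]
    (h : RegularlyVarying P Y α) {β : ℝ} (hβ0 : 0 < β) (hβ : α < β) :
    ∃ c y₀ : ℝ, 0 < c ∧ 0 < y₀ ∧ ∀ y, y₀ ≤ y → c * y ^ (-β) ≤ P.real {ω | y < |Y ω|} := by
  have hq2 : (2 : ℝ) ^ (-β) < (2 : ℝ) ^ (-α) :=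
    Real.rpow_lt_rpow_of_exponent_lt (by norm_num) (neg_lt_neg hβ)
  obtain ⟨y₁, hG⟩ := eventually_atTop.1 (h.eventually_le_tail hq2)
  set y₀ := max y₁ 1 with hy₀
  have hy0 : 0 < y₀ := lt_max_of_lt_right one_pos
  have hG0 := h.tail_pos (2 * y₀)
  refine ⟨P.real {ω | 2 * y₀ < |Y ω|} * y₀ ^ β, y₀, by positivity, hy0,
    doubling_induction hy0 (fun y h1 h2 => ?_) fun y h1 h2 => ?_⟩
  · have hm : y ^ (-β) ≤ y₀ ^ (-β) :=
      Real.rpow_le_rpow_of_nonpos hy0 h1 (by linarith)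
    calc P.real {ω | 2 * y₀ < |Y ω|} * y₀ ^ β * y ^ (-β)
        ≤ P.real {ω | 2 * y₀ < |Y ω|} * y₀ ^ β * y₀ ^ (-β) := by gcongr
      _ = P.real {ω | 2 * y₀ < |Y ω|} := by
        rw [mul_assoc, ← Real.rpow_add hy0, add_neg_cancel, Real.rpow_zero, mul_one]
      _ ≤ P.real {ω | y < |Y ω|} := tail_antitone P Y h2
  · rw [Real.mul_rpow two_pos.le (hy0.le.trans h1)]
    have := mul_le_mul_of_nonneg_left h2 (by positivity : 0 ≤ (2 : ℝ) ^ (-β))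
    have := hG y ((le_max_left _ _).trans h1)
    linarith

theorem RegularlyVarying.tendsto_normalisation [IsProbabilityMeasure P]
    (h : RegularlyVarying P Y α) {a : ℕ → ℝ}
    (ha : Tendsto (fun n : ℕ => (n : ℝ) * P.real {ω | a n < |Y ω|}) atTop (𝓝 1)) :
    Tendsto a atTop atTop := by
  have h0 : Tendsto (fun n : ℕ => P.real {ω | a n < |Y ω|}) atTop (𝓝 0) := by
    have := ha.mul tendsto_inv_atTop_nhds_zero_nat
    rw [mul_zero] at this
    refine this.congr' ?_
    filter_upwards [eventually_gt_atTop 0] with n hn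
    field_simp
  refine tendsto_atTop.2 fun b => ?_
  filter_upwards [h0.eventually_lt_const (h.tail_pos b)] with n hn
  by_contra! hlt
  exact absurd (tail_antitone P Y hlt.le) (not_le.2 hn)

theorem RegularlyVarying.tendsto_nat_mul_tail [IsProbabilityMeasure P]
    (h : RegularlyVarying P Y α) {a : ℕ → ℝ}
    (ha : Tendsto (fun n : ℕ => (n : ℝ) * P.real {ω | a n < |Y ω|}) atTop (𝓝 1)) {u : ℝ}
    (hu : 0 < u) :
    Tendsto (fun n : ℕ => (n : ℝ) * P.real {ω | u * a n < |Y ω|}) atTop (𝓝 (u ^ (-α))) := by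
  have h1 := ha.mul ((h.tail_ratio hu).comp (h.tendsto_normalisation ha))
  rw [one_mul] at h1
  refine h1.congr fun n => ?_
  have := (h.tail_pos (a n)).ne'
  simp only [Function.comp]
  field_simp

theorem RegularlyVarying.tendsto_mul_div_sq [IsProbabilityMeasure P]
    (h : RegularlyVarying P Y α) (hα : 0 < α) {a : ℕ → ℝ}
    (ha : Tendsto (fun n : ℕ => (n : ℝ) * P.real {ω | a n < |Y ω|}) atTop (𝓝 1)) {r : ℕ → ℕ}
    {s : ℝ} (hs : 0 < s) (hs' : s < 2 / α - 1)
    (hrs : (fun n : ℕ => (r n : ℝ)) =o[atTop] (fun n : ℕ => (n : ℝ) ^ s)) :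
    Tendsto (fun n : ℕ => (n : ℝ) * r n / a n ^ 2) atTop (𝓝 0) := by
  -- with `β = 2 / (1 + s)` the tail bound reads `a n ^ 2 ≥ const * n ^ (1 + s)`
  have hβ : α < 2 / (1 + s) := by
    rw [lt_div_iff₀ (by linarith), mul_comm, ← lt_div_iff₀ hα]
    linarith
  obtain ⟨c, y₀, hc, hy₀, hG⟩ := h.exists_tail_lower_bound (hα.trans hβ) hβ
  have h0 := (hrs.tendsto_div_nhds_zero).const_mul ((c / 2) ^ (-(1 + s)))
  rw [mul_zero] at h0
  refine tendsto_of_tendsto_of_tendsto_of_le_of_le' tendsto_const_nhds h0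
    (Eventually.of_forall fun n => by positivity) ?_
  filter_upwards [ha.eventually_lt_const (by norm_num : (1 : ℝ) < 2), eventually_gt_atTop 0,
    (h.tendsto_normalisation ha).eventually_ge_atTop y₀] with n hn hn0 han
  have hn0' : (0 : ℝ) < n := by exact_mod_cast hn0
  have ha0 : 0 < a n := hy₀.trans_le han
  have h1 : n * (c * a n ^ (-(2 / (1 + s)))) ≤ 2 :=
    (mul_le_mul_of_nonneg_left (hG _ han) hn0'.le).trans hn.le
  have h2 : c / 2 * n ≤ a n ^ (2 / (1 + s)) := by
    rw [Real.rpow_neg ha0.le] at h1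
    have hp := Real.rpow_pos_of_pos ha0 (2 / (1 + s))
    have h3 : n * c ≤ 2 * a n ^ (2 / (1 + s)) := by
      calc (n : ℝ) * c = n * (c * (a n ^ (2 / (1 + s)))⁻¹) * a n ^ (2 / (1 + s)) := by field_simp
        _ ≤ 2 * a n ^ (2 / (1 + s)) := by gcongr
    linarith
  have h4 : (c / 2) ^ (1 + s) * (n : ℝ) ^ (1 + s) ≤ a n ^ 2 := by
    rw [← Real.mul_rpow (by positivity) hn0'.le]
    refine (Real.rpow_le_rpow (by positivity) h2 (by linarith)).trans (le_of_eq ?_)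
    rw [← Real.rpow_mul ha0.le, div_mul_cancel₀ _ (by linarith)]
    norm_num
  have hpos : 0 < (c / 2) ^ (1 + s) * (n : ℝ) ^ (1 + s) := by positivity
  calc (n : ℝ) * r n / a n ^ 2 ≤ n * r n / ((c / 2) ^ (1 + s) * (n : ℝ) ^ (1 + s)) := by gcongr
    _ = (c / 2) ^ (-(1 + s)) * (r n / (n : ℝ) ^ s) := by
      rw [Real.rpow_neg (by positivity), Real.rpow_add hn0', Real.rpow_one]
      field_simp

end Tail

/-! ### Block sums and the conclusion -/

theorem StrictlyStationary.identDistrib {Ω : Type*} [MeasurableSpace Ω] {P : Measure Ω}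
    {X : ℤ → Ω → ℝ} (h : StrictlyStationary P X) (i : ℤ) : IdentDistrib (X i) (X 1) P P := by
  have h1 := (h (i - 1)).comp (measurable_pi_apply (1 : ℤ))
  simpa [Function.comp_def] using h1

theorem sum_Icc_eq_sum_range (f : ℤ → ℝ) (o : ℤ) (r : ℕ) :
    ∑ i ∈ Finset.Icc (o + 1) (o + r), f i = ∑ i ∈ Finset.range r, f (o + (i + 1)) := by
  symm
  refine Finset.sum_nbij' (fun i : ℕ => o + (i + 1)) (fun j : ℤ => (j - o - 1).toNat) ?_ ?_ ?_ ?_ ?_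
  · intro i hi
    have := Finset.mem_range.1 hi
    simp only [Finset.mem_Icc]
    omega
  · intro j hj
    have := Finset.mem_Icc.1 hj
    simp only [Finset.mem_range]
    omega
  · intro i _
    omega
  · intro j hj
    have := Finset.mem_Icc.1 hj
    omega
  · intro i _
    rfl

theorem truncAt_div {a : ℝ} (ha : 0 < a) (u x : ℝ) : truncAt u (x / a) = truncAt (u * a) x / a := by
  simp only [truncAt_eq_ite, abs_div, abs_of_pos ha, div_le_iff₀ ha]
  split_ifs <;> simp

/-- A truncated sum is controlled by the sum of the truncated, centred terms, by the centring
`r c`, and, if some term exceeds the level, by the level itself. -/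
theorem truncAt_sum_sq_le {t : ℝ} (r : ℕ) (x : ℕ → ℝ) (c : ℝ) :
    truncAt t (∑ i ∈ Finset.range r, x i) ^ 2 ≤
      2 * (∑ i ∈ Finset.range r, (truncAt t (x i) - c)) ^ 2 + 2 * (r * c) ^ 2 +
        t ^ 2 * ∑ i ∈ Finset.range r, Set.indicator {y : ℝ | t < |y|} 1 (x i) := by
  have hnn : ∀ i ∈ Finset.range r, (0 : ℝ) ≤ Set.indicator {y : ℝ | t < |y|} 1 (x i) := fun i _ =>
    Set.indicator_nonneg (fun _ _ => zero_le_one) _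
  have h0 := Finset.sum_nonneg hnn
  by_cases h : ∀ i ∈ Finset.range r, |x i| ≤ t
  · have e : ∑ i ∈ Finset.range r, x i =
        ∑ i ∈ Finset.range r, (truncAt t (x i) - c) + r * c := by
      rw [Finset.sum_sub_distrib]
      simp only [Finset.sum_const, Finset.card_range, nsmul_eq_mul, sub_add_cancel]
      exact Finset.sum_congr rfl fun i hi => by rw [truncAt_eq_ite, if_pos (h i hi)]
    have h1 : truncAt t (∑ i ∈ Finset.range r, x i) ^ 2 ≤ (∑ i ∈ Finset.range r, x i) ^ 2 := by
      rw [truncAt_eq_ite]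
      split_ifs
      · exact le_rfl
      · nlinarith [sq_nonneg (∑ i ∈ Finset.range r, x i)]
    rw [e] at h1
    have h2 := mul_nonneg (sq_nonneg t) h0
    rw [e]
    nlinarith [sq_nonneg (∑ i ∈ Finset.range r, (truncAt t (x i) - c) - r * c)]
  · push Not at h
    obtain ⟨i, hi, hti⟩ := h
    have h1 : (1 : ℝ) ≤ ∑ i ∈ Finset.range r, Set.indicator {y : ℝ | t < |y|} 1 (x i) := by
      refine le_trans ?_ (Finset.single_le_sum hnn hi)
      simp [hti]
    have h2 : truncAt t (∑ i ∈ Finset.range r, x i) ^ 2 ≤ t ^ 2 := by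
      rw [truncAt_eq_ite]
      split_ifs with h3
      · exact sq_le_sq.2 (h3.trans (le_abs_self t))
      · nlinarith [sq_nonneg t]
    nlinarith [mul_le_mul_of_nonneg_left h1 (sq_nonneg t),
      sq_nonneg (∑ i ∈ Finset.range r, (truncAt t (x i) - c)), sq_nonneg (r * c)]

theorem measurable_blockSum {Ω : Type*} (X : ℤ → Ω → ℝ) (r i : ℕ) :
    Measurable[sigmaField X (Set.Ioc (0 + i * r) (0 + (i + 1) * r))] (blockSum X r (i + 1)) := by
  refine Finset.measurable_fun_sum _ fun j hj => measurable_sigmaField X ?_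
  have h := Finset.mem_Icc.1 hj
  push_cast at h
  rw [add_sub_cancel_right] at h
  constructor <;> linarith [h.1, h.2]

section Block

variable {Ω : Type*} [MeasurableSpace Ω] {P : Measure Ω} [IsProbabilityMeasure P]
  {X : ℤ → Ω → ℝ}

theorem integral_truncAt_blockSum_sq_le (hX : ∀ n, Measurable (X n)) (hstat : StrictlyStationary P X)
    {C : ℝ} (hC : IsMaximalConstant P (rhoMixing P X) C)
    {r : ℕ} (hr : 0 < r) (k : ℕ) {t : ℝ} (ht : 0 ≤ t) :
    ∫ ω, truncAt t (blockSum X r k ω) ^ 2 ∂P ≤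
      2 * (C * r * ∫ ω, truncAt t (X 1 ω) ^ 2 ∂P) +
        2 * (r * ∫ ω, |truncAt t (X 1 ω)| ∂P) ^ 2 + t ^ 2 * (r * P.real {ω | t < |X 1 ω|}) := by
  -- inside a block the maximal inequality is applied with blocks of length one
  set o : ℤ := ((k : ℤ) - 1) * r with ho
  set c : ℝ := ∫ ω, truncAt t (X 1 ω) ∂P with hc
  have hid : ∀ i, IdentDistrib (fun ω => truncAt t (X i ω)) (fun ω => truncAt t (X 1 ω)) P P :=
    fun i => (hstat.identDistrib i).comp (measurable_truncAt t)
  have hT : ∀ i, MemLp (fun ω => truncAt t (X i ω)) 2 P := fun i => memLp_truncAt (hX i) ht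
  have hTc : ∀ i, ∫ ω, truncAt t (X i ω) ∂P = c := fun i => (hid i).integral_eq
  set Y : ℕ → Ω → ℝ := fun i ω => truncAt t (X (o + (i + 1)) ω) - c with hYdef
  have hY : ∀ i, MemLp (Y i) 2 P := fun i => (hT _).sub (memLp_const c)
  have hY0 : ∀ i, ∫ ω, Y i ω ∂P = 0 := fun i => by
    simp only [hYdef]
    rw [integral_sub ((hT _).integrable (by norm_num)) (integrable_const c), hTc]
    simp
  have hYσ : ∀ i, lpNorm (Y i) 2 P ≤ lpNorm (fun ω => truncAt t (X 1 ω)) 2 P := fun i => by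
    have h1 := lpNorm_sub_integral_le (hT (o + (i + 1)))
    rw [hTc] at h1
    refine h1.trans (le_of_eq ?_)
    rw [← toReal_eLpNorm (hT _).1, ← toReal_eLpNorm (hT _).1, (hid _).eLpNorm_eq]
  have hYm : ∀ i : ℕ, Measurable[sigmaField X (Set.Ioc (o + i * (1 : ℕ)) (o + (i + 1) * (1 : ℕ)))]
      (Y i) := fun i =>
    ((measurable_truncAt t).comp (measurable_sigmaField X (by simp))).sub_const c
  have hmix := mixingBound_blockFiltration hX o one_pos hY hY0 hYm
  obtain ⟨g, hg2, hgn, hg⟩ := hC _ Y _ hmix hY (fun i => (hYm i).mono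
    (sigmaField_mono X (by push_cast; exact Set.Ioc_subset_Iic_self)) le_rfl) hYσ r hr
  have hblock : ∀ ω, blockSum X r k ω = ∑ i ∈ Finset.range r, X (o + (i + 1)) ω := fun ω => by
    rw [← sum_Icc_eq_sum_range (fun i => X i ω) o r, blockSum]
    congr 2
    rw [ho]
    ring
  have hpt : ∀ ω, truncAt t (blockSum X r k ω) ^ 2 ≤ 2 * g ω ^ 2 + 2 * (r * c) ^ 2 +
      t ^ 2 * ∑ i ∈ Finset.range r, Set.indicator {ω | t < |X (o + (i + 1)) ω|} 1 ω := fun ω => by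
    rw [hblock]
    refine (truncAt_sum_sq_le r (fun i => X (o + (i + 1)) ω) c).trans ?_
    have h1 := hg ω r le_rfl
    have h2 : (∑ i ∈ Finset.range r, Y i ω) ^ 2 ≤ g ω ^ 2 :=
      sq_le_sq.2 (h1.trans (le_abs_self _))
    have h3 : (∑ i ∈ Finset.range r, (truncAt t (X (o + (i + 1)) ω) - c)) ^ 2 ≤ g ω ^ 2 := h2
    have h4 : ∑ i ∈ Finset.range r, Set.indicator {y : ℝ | t < |y|} 1 (X (o + (i + 1)) ω) =
        ∑ i ∈ Finset.range r, Set.indicator {ω | t < |X (o + (i + 1)) ω|} (1 : Ω → ℝ) ω := rfl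
    rw [h4]
    linarith
  have hS : ∀ i, MeasurableSet {ω | t < |X i ω|} := fun i => measurableSet_tail (hX i) t
  have hI : ∀ i, Integrable (Set.indicator {ω | t < |X i ω|} (1 : Ω → ℝ)) P := fun i =>
    (integrable_const (1 : ℝ)).indicator (hS i)
  have hI1 : ∀ i, ∫ ω, Set.indicator {ω | t < |X i ω|} (1 : Ω → ℝ) ω ∂P =
      P.real {ω | t < |X 1 ω|} := fun i => by
    rw [integral_indicator_one (hS i)]
    exact congrArg ENNReal.toReal ((hstat.identDistrib i).measure_mem_eq
      (s := {y : ℝ | t < |y|}) (measurableSet_lt measurable_const continuous_abs.measurable))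
  have hIs : Integrable (fun ω => ∑ i ∈ Finset.range r,
      Set.indicator {ω | t < |X (o + (i + 1)) ω|} (1 : Ω → ℝ) ω) P :=
    integrable_finsetSum _ fun i _ => hI _
  have hi1 : Integrable (fun ω => 2 * g ω ^ 2 + 2 * (r * c) ^ 2) P :=
    (hg2.integrable_sq.const_mul 2).add (integrable_const _)
  have hbm : Measurable (blockSum X r k) := Finset.measurable_fun_sum _ fun i _ => hX i
  have hmono := integral_mono (memLp_truncAt hbm ht (P := P)).integrable_sq
    (hi1.add (hIs.const_mul (t ^ 2))) hpt
  have e : ∫ ω, (2 * g ω ^ 2 + 2 * (r * c) ^ 2 + t ^ 2 *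
      ∑ i ∈ Finset.range r, Set.indicator {ω | t < |X (o + (i + 1)) ω|} (1 : Ω → ℝ) ω) ∂P =
      2 * lpNorm g 2 P ^ 2 + 2 * (r * c) ^ 2 + t ^ 2 * (r * P.real {ω | t < |X 1 ω|}) := by
    rw [integral_add hi1 (hIs.const_mul _),
      integral_add (hg2.integrable_sq.const_mul 2) (integrable_const _), integral_const_mul,
      integral_const_mul, integral_const_mul, integral_finsetSum _ fun i _ => hI _, lpNorm_two_sq hg2.1]
    simp [hI1]
  refine (hmono.trans e.le).trans ?_
  have hcabs : (r * c) ^ 2 ≤ (r * ∫ ω, |truncAt t (X 1 ω)| ∂P) ^ 2 := by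
    rw [mul_pow, mul_pow]
    refine mul_le_mul_of_nonneg_left ?_ (sq_nonneg _)
    exact sq_le_sq.2 ((abs_integral_le_integral_abs).trans (le_abs_self _))
  rw [lpNorm_two_sq (hT 1).1] at hgn
  linarith

theorem measure_le_ofReal_lpNorm_sq_div {g : Ω → ℝ} (hg : MemLp g 2 P) {δ : ℝ} (hδ : 0 < δ) {E : Set Ω}
    (hE : ∀ ω ∈ E, δ ≤ g ω) : P E ≤ ENNReal.ofReal (lpNorm g 2 P ^ 2 / δ ^ 2) := by
  have h1 := mul_meas_ge_le_integral_of_nonneg (μ := P)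
    (Eventually.of_forall fun ω => sq_nonneg (g ω)) hg.integrable_sq (δ ^ 2)
  rw [← lpNorm_two_sq hg.1] at h1
  calc P E ≤ P {ω | δ ^ 2 ≤ g ω ^ 2} :=
        measure_mono fun ω hω =>
          Set.mem_ofPred.2 (pow_le_pow_left₀ hδ.le (hE ω hω) 2)
    _ = ENNReal.ofReal (P.real {ω | δ ^ 2 ≤ g ω ^ 2}) := (ofReal_measureReal).symm
    _ ≤ _ := ENNReal.ofReal_le_ofReal (by rw [le_div_iff₀ (by positivity), mul_comm]; exact h1)

/-- The bound for fixed `n`: the maximal inequality for the centred blocks, with the variance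
estimate of a single block inserted. -/
theorem measure_max_centredBlock_le (hX : ∀ n, Measurable (X n)) (hstat : StrictlyStationary P X)
    {C : ℝ} (hC0 : 0 ≤ C) (hC : IsMaximalConstant P (rhoMixing P X) C)
    {r : ℕ} (hr : 0 < r) {a u δ M K : ℝ} (ha : 0 < a) (hu : 0 ≤ u) (hδ : 0 < δ)
    (hM : ∫ ω, |truncAt (u * a) (X 1 ω)| ∂P ≤ M)
    (hK : ∫ ω, truncAt (u * a) (X 1 ω) ^ 2 ∂P ≤
      K * ((u * a) ^ 2 * P.real {ω | u * a < |X 1 ω|})) (n : ℕ) :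
    P {ω | ∃ j ∈ Finset.Icc 1 (n / r), δ < |∑ k ∈ Finset.Icc 1 j, centredBlock P X a r u k ω|} ≤
      ENNReal.ofReal (C / δ ^ 2 * ((2 * C * K + 1) * (u ^ 2 * (n * P.real {ω | u * a < |X 1 ω|})) +
        2 * M ^ 2 * (n * r / a ^ 2))) := by
  have hua : 0 ≤ u * a := by positivity
  rcases Nat.eq_zero_or_pos (n / r) with hk | hk
  · simp [hk]
  set G := P.real {ω | u * a < |X 1 ω|} with hG
  have hG0 : 0 ≤ G := measureReal_nonneg
  set V := 2 * (C * r * (K * ((u * a) ^ 2 * G))) + 2 * (r * M) ^ 2 + (u * a) ^ 2 * (r * G) with hV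
  have hbm : ∀ k, Measurable (blockSum X r k) := fun k =>
    Finset.measurable_fun_sum _ fun i _ => hX i
  have hT : ∀ k, MemLp (fun ω => truncAt u (blockSum X r k ω / a)) 2 P := fun k =>
    memLp_truncAt ((hbm k).div_const a) hu
  have hM0 : 0 ≤ ∫ ω, |truncAt (u * a) (X 1 ω)| ∂P := integral_nonneg fun _ => abs_nonneg _
  have hTV : ∀ k, lpNorm (fun ω => truncAt u (blockSum X r k ω / a)) 2 P ^ 2 ≤ V / a ^ 2 := by
    intro k
    rw [lpNorm_two_sq (hT k).1]
    simp_rw [truncAt_div ha, div_pow]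
    rw [integral_div]
    refine div_le_div_of_nonneg_right ?_ (by positivity)
    refine (integral_truncAt_blockSum_sq_le hX hstat hC hr k hua).trans ?_
    rw [hV]
    gcongr
  have hV0 : 0 ≤ V / a ^ 2 := (sq_nonneg _).trans (hTV 0)
  set Y : ℕ → Ω → ℝ := fun i => centredBlock P X a r u (i + 1) with hYdef
  have hY : ∀ i, MemLp (Y i) 2 P := fun i => (hT _).sub (memLp_const _)
  have hY0 : ∀ i, ∫ ω, Y i ω ∂P = 0 := fun i => by
    simp only [hYdef, centredBlock]
    rw [integral_sub ((hT _).integrable (by norm_num)) (integrable_const _)]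
    simp
  have hYσ : ∀ i, lpNorm (Y i) 2 P ≤ √(V / a ^ 2) := fun i =>
    (lpNorm_sub_integral_le (hT (i + 1))).trans (Real.le_sqrt_of_sq_le (hTV _))
  have hYm : ∀ i : ℕ, Measurable[sigmaField X (Set.Ioc (0 + i * r) (0 + (i + 1) * r))] (Y i) :=
    fun i => ((measurable_truncAt u).comp ((measurable_blockSum X r i).div_const a)).sub_const _
  have hmix := mixingBound_blockFiltration hX 0 hr hY hY0 hYm
  obtain ⟨g, hg2, hgn, hg⟩ := hC _ Y _ hmix hY (fun i => (hYm i).mono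
    (sigmaField_mono X (by push_cast; exact Set.Ioc_subset_Iic_self)) le_rfl) hYσ (n / r) hk
  refine (measure_le_ofReal_lpNorm_sq_div hg2 hδ ?_).trans (ENNReal.ofReal_le_ofReal ?_)
  · rintro ω ⟨j, hj, hlt⟩
    refine hlt.le.trans (le_of_eq_of_le ?_ (hg ω j (Finset.mem_Icc.1 hj).2))
    congr 1
    rw [Finset.range_eq_Ico, Finset.sum_Ico_add' (fun k => centredBlock P X a r u k ω) 0 j 1]
    rfl
  · rw [Real.sq_sqrt hV0] at hgn
    rw [div_mul_eq_mul_div]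
    refine div_le_div_of_nonneg_right (hgn.trans ?_) (by positivity)
    rw [mul_assoc]
    refine mul_le_mul_of_nonneg_left ?_ hC0
    have hkr : ((n / r : ℕ) : ℝ) * r ≤ n := by exact_mod_cast Nat.div_mul_le_self n r
    have e1 : ((n / r : ℕ) : ℝ) * (V / a ^ 2) = (((n / r : ℕ) : ℝ) * r) * (V / (r * a ^ 2)) := by
      have : (0 : ℝ) < r := by exact_mod_cast hr
      field_simp
    have e2 : n * (V / (r * a ^ 2)) = (2 * C * K + 1) * (u ^ 2 * (n * G)) +
        2 * M ^ 2 * (n * r / a ^ 2) := by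
      have : (0 : ℝ) < r := by exact_mod_cast hr
      rw [hV]
      field_simp
      ring
    rw [e1, ← e2]
    refine mul_le_mul_of_nonneg_right hkr ?_
    have : V / (r * a ^ 2) = V / a ^ 2 / r := by rw [div_div, mul_comm]
    rw [this]
    positivity

end Block

theorem tendsto_div_blockLength {r : ℕ → ℕ} (hr : ∀ n, 0 < r n) {s : ℝ} (hs : s ≤ 1)
    (hrs : (fun n : ℕ => (r n : ℝ)) =o[atTop] (fun n : ℕ => (n : ℝ) ^ s)) :
    Tendsto (fun n => n / r n) atTop atTop := by
  refine tendsto_atTop.2 fun b => ?_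
  filter_upwards [hrs.bound (by positivity : (0 : ℝ) < 1 / (b + 1)), eventually_ge_atTop 1]
    with n hn hn1
  rw [Nat.le_div_iff_mul_le (hr n)]
  have hn1' : (1 : ℝ) ≤ n := by exact_mod_cast hn1
  have h1 : (n : ℝ) ^ s ≤ n := by
    simpa using Real.rpow_le_rpow_of_exponent_le hn1' hs
  rw [Real.norm_of_nonneg (by positivity), Real.norm_of_nonneg (by positivity)] at hn
  have h2 : (r n : ℝ) ≤ 1 / (b + 1) * n := hn.trans (by gcongr)
  have h3 : (b : ℝ) * r n ≤ n := by
    rw [one_div, inv_mul_eq_div, le_div_iff₀ (by positivity)] at h2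
    have : (0 : ℝ) ≤ r n := by positivity
    linarith
  exact_mod_cast h3

theorem propositionp {Ω : Type*} [MeasurableSpace Ω] (P : Measure Ω) [IsProbabilityMeasure P]
    (X : ℤ → Ω → ℝ) (hXmeas : ∀ n, Measurable (X n)) (hXstat : StrictlyStationary P X)
    (α : ℝ) (hα : 1 < α) (hα' : α < 2) (hXreg : RegularlyVarying P (X 1) α)
    (a : ℕ → ℝ) (ha : ∀ n, 0 < a n)
    (haX : Tendsto (fun n : ℕ => (n : ℝ) * P.real {ω | a n < |X 1 ω|}) atTop (𝓝 1))
    (r : ℕ → ℕ) (hr : ∀ n, 0 < r n) (hr' : Tendsto r atTop atTop)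
    (s : ℝ) (hs : 0 < s) (hs' : s < 2 / α - 1)
    (hrs : (fun n : ℕ => (r n : ℝ)) =o[atTop] (fun n : ℕ => (n : ℝ) ^ s))
    (hρanti : Antitone (rhoMixing P X))
    (hρ : Tendsto (rhoMixing P X) atTop (𝓝 0))
    (hρsum : Summable (fun j : ℕ => rhoMixing P X ⌊(2 : ℝ) ^ ((j : ℝ) / 3)⌋₊)) :
    SmallBlocksNegligible P X a r := by
  have hα0 : 0 < α := by linarith
  have hs1 : s ≤ 1 := by
    have : 2 / α < 2 := by
      rw [div_lt_iff₀ hα0]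
      linarith
    linarith
  refine ⟨hr, hr', tendsto_div_blockLength hr hs1 hrs, fun δ hδ => ?_⟩
  obtain ⟨C, hC0, hC⟩ := exists_isMaximalConstant P (rhoMixing_nonneg P X) (rhoMixing_le_one P X)
    hρsum
  obtain ⟨M, -, hM⟩ := hXreg.exists_truncated_mean_bound (hXmeas 1) hα
  obtain ⟨K, y₀, hK0, hy₀, hK⟩ := hXreg.exists_truncated_moment_bound (hXmeas 1) hα'
  have hatop := hXreg.tendsto_normalisation haX
  have hlim : Tendsto (fun u : ℝ => ENNReal.ofReal (C / δ ^ 2 * ((2 * C * K + 1) * u ^ (2 - α))))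
      (𝓝[>] 0) (𝓝 0) := by
    have h1 : Tendsto (fun u : ℝ => u ^ (2 - α)) (𝓝[>] 0) (𝓝 0) := by
      have := (Real.continuousAt_rpow_const 0 (2 - α) (Or.inr (by linarith))).tendsto
      rw [Real.zero_rpow (by linarith)] at this
      exact this.mono_left nhdsWithin_le_nhds
    have h2 := (ENNReal.continuous_ofReal.tendsto _).comp
      ((h1.const_mul (2 * C * K + 1)).const_mul (C / δ ^ 2))
    simpa [Function.comp_def] using h2
  refine tendsto_of_tendsto_of_tendsto_of_le_of_le' tendsto_const_nhds hlim
    (Eventually.of_forall fun _ => zero_le) ?_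
  filter_upwards [self_mem_nhdsWithin] with u hu
  have hu0 : 0 < u := hu
  have hb : Tendsto (fun n : ℕ => ENNReal.ofReal (C / δ ^ 2 * ((2 * C * K + 1) *
      (u ^ 2 * (n * P.real {ω | u * a n < |X 1 ω|})) + 2 * M ^ 2 * (n * r n / a n ^ 2)))) atTop
      (𝓝 (ENNReal.ofReal (C / δ ^ 2 * ((2 * C * K + 1) * u ^ (2 - α))))) := by
    have e : C / δ ^ 2 * ((2 * C * K + 1) * u ^ (2 - α)) =
        C / δ ^ 2 * ((2 * C * K + 1) * (u ^ 2 * u ^ (-α)) + 2 * M ^ 2 * 0) := by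
      rw [sub_eq_add_neg, Real.rpow_add hu0, Real.rpow_two]
      ring
    rw [e]
    refine (ENNReal.continuous_ofReal.tendsto _).comp (Tendsto.const_mul _ ?_)
    exact (((hXreg.tendsto_nat_mul_tail haX hu0).const_mul _).const_mul _).add
      ((hXreg.tendsto_mul_div_sq hα0 haX hs hs' hrs).const_mul _)
  rw [← hb.limsup_eq]
  refine limsup_le_limsup ?_
  filter_upwards [(hatop.const_mul_atTop hu0).eventually_ge_atTop y₀] with n hn
  exact measure_max_centredBlock_le hXmeas hXstat hC0 hC (hr n) (ha n) hu0.le hδ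
    (hM _ (hy₀.le.trans hn)) (hK _ hn) n
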